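/- Let $d \in \mathbb{N}$, let $|\cdot|$ and $\cdot$ be the Euclidean norm and inner product of $\mathbb{R}^{d+1}$, and let $\mathbb{S}^d\subset\mathbb{R}^{d+1}$ be the unit sphere. Let $X([0,\infty))$ and $X([0,\infty)^2)$ be the sets of continuous $\mathbb{S}^d$-valued functions on $[0,\infty)$ and $[0,\infty)^2$, and let $C([0,\infty)^2) \supset X([0,\infty)^2)$ be the space of continuous $\mathbb{R}^{d+1}$-valued functions on $[0,\infty)^2$; all are equipped with the topology of locally uniform convergence and its Borel $\sigma$-algebra. **Wave maps.** Let $\phi_+,\phi_-\in X([0,\infty))$. A function $\phi\in X([0,\infty)^2)$ is a wave map with boundary data $\phi_\pm$ if, for all $u_0,v_0>0$, the classical derivatives $\partial_u\phi$ and $\partial_v\phi$ exist almost everywhere in $[0,u_0]\times[0,v_0]$, $\partial_u\phi\cdot\partial_v\phi\in L^1([0,u_0]\times[0,v_0])$, and for all $(u,v)\in[0,u_0]\times[0,v_0]$ $$\phi(u,v)=\phi_+(u)+\phi_-(v)-\phi_+(0)-\int_0^u\!\int_0^v\big[(\partial_u\phi\cdot\partial_v\phi)\,\phi\big](w,z)\,dz\,dw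 .$$ The (Keel–Tao) solution map $\Phi$ sends boundary data $(\phi_+,\phi_-)$ to the wave map with these boundary data (and takes an arbitrary value in $X([0,\infty)^2)$ where there is none). **Numerical scheme.** For $P,Q\in\mathbb{R}^{d+1}$ let $\mathcal{R}_QP:=2|Q|^{-2}(Q\cdot P)Q-P$ if $Q\neq0$, and $\mathcal{R}_0P:=-P$. Given $\phi_\pm\in X([0,\infty))$ with $\phi_+(0)=\phi_-(0)$ and $N\in\mathbb{N}$, let $Y:\mathbb{N}^2\to\mathbb{S}^d$ be the unique discrete field with $Y(m,0)=\phi_+(2^{-N}m)$, $Y(0,n)=\phi_-(2^{-N}n)$ and $$Y(m+1,n+1)=\mathcal{R}_{Y(m+1,n)+Y(m,n+1)}Y(m,n)\qquad\text{for all } m,n\in\mathbb{N}.$$ Let $\widetilde Y:[0,\infty)^2\to\mathbb{R}^{d+1}$ be the continuous function that agrees with $Y$ on $\mathbb{N}^2$ and is affine separately in each variable on every unit square with integer vertices, and set $\Phi_N(\phi_+,\phi_-)(u,v):=\widetilde Y(2^Nu,2^Nv)$, an element of $C([0,\infty)^2)$. **Solutions for random data.** Let $(\Omega,\mathbb{P})$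 be a probability space and let $\phi_+,\phi_-:\Omega\to X([0,\infty))$ be random functions with $\phi_-(0)=\phi_+(0)$ almost surely. A random field $\phi:\Omega'\to X([0,\infty)^2)$, defined on some probability space $(\Omega',\mathbb{P}')$, is a solution with boundary data $\phi_\pm$ if there is a strictly increasing sequence $(N_k)$ of natural numbers such that $\Phi_{N_k}(\phi_+,\phi_-)\to\phi$ in distribution on $C([0,\infty)^2)$ as $k\to\infty$. **Corollary.** Let $\phi_+,\phi_-:\Omega\to X([0,\infty))$ be random functions such that, almost surely, $\phi_-(0)=\phi_+(0)$ and $\phi_+,\phi_-$ are locally absolutely continuous on $[0,\infty)$. Then: 1. almost surely, $\Phi(\phi_+^{(\omega)},\phi_-^{(\omega)})$ is a wave map with boundary data $\phi_\pm^{(\omega)}$, and it is the only one; 2. $\widetilde\phi:\omega\mapsto\Phi(\phi_+^{(\omega)},\phi_-^{(\omega)})$ is (almost everywhere equal to) a random field and is a solution with boundary data $\phi_\pm$; 3. every solution $\phi:\Omega'\to X([0,\infty)^2)$ with boundary data $\phi_\pm$, on any probability space $\Omega'$, has the same law on $X([0,\infty)^2)$ as $\widetilde\phi$. -/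

import Mathlib

open MeasureTheory ProbabilityTheory Filter Set Topology
open scoped NNReal

noncomputable section

namespace WaveMaps

/-! ### Path spaces -/

/-- The ambient Euclidean space `ℝ^{d+1}`. -/
abbrev E (d : ℕ) : Type := EuclideanSpace ℝ (Fin (d + 1))

/-- The unit sphere `𝕊^d` of `ℝ^{d+1}`. -/
abbrev S (d : ℕ) : Type := Metric.sphere (0 : E d) 1

/-- Continuous `𝕊^d`-valued functions on `[0, ∞)`, with locally uniform convergence
(the compact-open topology). -/
abbrev X₁ (d : ℕ) : Type := C(ℝ≥0, S d)

/-- Continuous `𝕊^d`-valued functions on `[0, ∞)²`, with locally uniform convergence. -/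
abbrev X₂ (d : ℕ) : Type := C(ℝ≥0 × ℝ≥0, S d)

/-- Continuous `ℝ^{d+1}`-valued functions on `[0, ∞)²`, with locally uniform convergence. -/
abbrev C₂ (d : ℕ) : Type := C(ℝ≥0 × ℝ≥0, E d)

/-- Spaces of continuous functions carry the Borel σ-algebra of the compact-open topology. -/
instance instMeasurableSpaceContinuousMap {A B : Type*} [TopologicalSpace A]
    [TopologicalSpace B] : MeasurableSpace C(A, B) := borel _

instance instBorelSpaceContinuousMap {A B : Type*} [TopologicalSpace A]
    [TopologicalSpace B] : BorelSpace C(A, B) := ⟨rfl⟩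

/-- The inclusion of the `𝕊^d`-valued functions in the `ℝ^{d+1}`-valued ones. -/
def incl {d : ℕ} (φ : X₂ d) : C₂ d := ⟨fun p => (φ p : E d), by fun_prop⟩

/-- A path on `[0, ∞)` as a function of a real variable (constant for negative arguments). -/
def lift₁ {d : ℕ} (φ : X₁ d) (u : ℝ) : E d := φ u.toNNReal

/-- A field on `[0, ∞)²` as a function of two real variables (the values outside the quadrant
play no role below). -/
def lift₂ {d : ℕ} (φ : X₂ d) (u v : ℝ) : E d := φ (u.toNNReal, v.toNNReal)

/-- Local absolute continuity on `[0, ∞)`, that is `φ' ∈ L¹_loc([0, ∞))`. -/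
def LocallyAC {d : ℕ} (φ : X₁ d) : Prop :=
  ∀ a : ℝ, 0 < a → AbsolutelyContinuousOnInterval (lift₁ φ) 0 a

/-! ### Wave maps with given boundary data -/

/-- The density `(∂_u f · ∂_v f)` of the nonlinearity. -/
def nullForm {d : ℕ} (f : ℝ → ℝ → E d) (u v : ℝ) : ℝ :=
  inner ℝ (deriv (fun w => f w v) u) (deriv (fun z => f u z) v)

/-- `f` is a wave map on the rectangle `[0, u₀] × [0, v₀]` with boundary data `fp = f(·, 0)` and
`fm = f(0, ·)`. -/
structure IsWaveMapOn {d : ℕ} (u₀ v₀ : ℝ) (fp fm : ℝ → E d) (f : ℝ → ℝ → E d) : Prop where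
  norm_eq_one : ∀ u ∈ Icc 0 u₀, ∀ v ∈ Icc 0 v₀, ‖f u v‖ = 1
  ae_differentiableAt : ∀ᵐ p ∂((volume : Measure (ℝ × ℝ)).restrict (Icc 0 u₀ ×ˢ Icc 0 v₀)),
    DifferentiableAt ℝ (fun w => f w p.2) p.1 ∧ DifferentiableAt ℝ (fun z => f p.1 z) p.2
  integrable : IntegrableOn (fun p : ℝ × ℝ => nullForm f p.1 p.2) (Icc 0 u₀ ×ˢ Icc 0 v₀) volume
  eq_integral : ∀ u ∈ Icc 0 u₀, ∀ v ∈ Icc 0 v₀,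
    f u v = fp u + fm v - fp 0 - ∫ w in (0 : ℝ)..u, ∫ z in (0 : ℝ)..v, nullForm f w z • f w z

/-- `φ` is a wave map on `[0, ∞)²` with boundary data `φp = φ(·, 0)`, `φm = φ(0, ·)`: its
restriction to every rectangle `[0, u₀] × [0, v₀]` is one. -/
def IsWaveMap {d : ℕ} (φp φm : X₁ d) (φ : X₂ d) : Prop :=
  ∀ u₀ v₀ : ℝ, 0 < u₀ → 0 < v₀ → IsWaveMapOn u₀ v₀ (lift₁ φp) (lift₁ φm) (lift₂ φ)

open Classical in
/-- The solution map: a wave map with boundary data `φp`, `φm` (a constant map if there is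
none). -/
def solutionMap {d : ℕ} (φp φm : X₁ d) : X₂ d :=
  if h : ∃ φ, IsWaveMap φp φm φ then h.choose else ContinuousMap.const _ (φp 0)

/-! ### The numerical scheme -/

/-- The reflection `P ↦ 2 |Q|⁻² (Q · P) Q - P` with respect to the line spanned by `Q`;
for `Q = 0` it is `P ↦ -P`. -/
def lineReflection {d : ℕ} (Q P : E d) : E d :=
  (2 * (‖Q‖ ^ 2)⁻¹ * inner ℝ Q P) • Q - P

/-- The discrete wave map `Y` with boundary data `Y(m, 0) = Yp m`, `Y(0, n) = Ym n` (the value at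
the corner being `Yp 0`). -/
def discreteWaveMap {d : ℕ} (Yp Ym : ℕ → E d) : ℕ → ℕ → E d
  | m, 0 => Yp m
  | 0, n + 1 => Ym (n + 1)
  | m + 1, n + 1 =>
      lineReflection (discreteWaveMap Yp Ym (m + 1) n + discreteWaveMap Yp Ym m (n + 1))
        (discreteWaveMap Yp Ym m n)
termination_by m n => (n, m)

/-- The fractional part of `u ≥ 0`. -/
def frac (u : ℝ≥0) : ℝ := (u : ℝ) - (⌊u⌋₊ : ℝ)

/-- The extension of a discrete field to `[0, ∞)²`, affine separately in each variable on every
elementary square. -/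
def bilinExtend {d : ℕ} (Y : ℕ → ℕ → E d) (p : ℝ≥0 × ℝ≥0) : E d :=
  ((1 - frac p.1) * (1 - frac p.2)) • Y ⌊p.1⌋₊ ⌊p.2⌋₊
    + (frac p.1 * (1 - frac p.2)) • Y (⌊p.1⌋₊ + 1) ⌊p.2⌋₊
    + ((1 - frac p.1) * frac p.2) • Y ⌊p.1⌋₊ (⌊p.2⌋₊ + 1)
    + (frac p.1 * frac p.2) • Y (⌊p.1⌋₊ + 1) (⌊p.2⌋₊ + 1)

theorem frac_cases {u : ℝ≥0} {m : ℕ} (h : u ∈ Icc (m : ℝ≥0) (m + 1)) :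
    (⌊u⌋₊ = m ∧ frac u = (u : ℝ) - m) ∨
      (⌊u⌋₊ = m + 1 ∧ frac u = 0 ∧ (u : ℝ) - m = 1) := by
  rcases h.2.lt_or_eq with h2 | h2
  · have hf : ⌊u⌋₊ = m := (Nat.floor_eq_iff bot_le).2 ⟨h.1, h2⟩
    exact Or.inl ⟨hf, by rw [frac, hf]⟩
  · have hf : ⌊u⌋₊ = m + 1 := by
      rw [h2]
      exact_mod_cast Nat.floor_natCast (m + 1)
    refine Or.inr ⟨hf, ?_, ?_⟩
    · rw [frac, hf, h2]
      push_cast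
      ring
    · rw [h2]
      push_cast
      ring

theorem bilinExtend_eqOn {d : ℕ} (Y : ℕ → ℕ → E d) (m n : ℕ) :
    EqOn (bilinExtend Y)
      (fun p : ℝ≥0 × ℝ≥0 =>
        ((1 - ((p.1 : ℝ) - m)) * (1 - ((p.2 : ℝ) - n))) • Y m n
        + (((p.1 : ℝ) - m) * (1 - ((p.2 : ℝ) - n))) • Y (m + 1) n
        + ((1 - ((p.1 : ℝ) - m)) * ((p.2 : ℝ) - n)) • Y m (n + 1)
        + (((p.1 : ℝ) - m) * ((p.2 : ℝ) - n)) • Y (m + 1) (n + 1))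
      (Icc (m : ℝ≥0) (m + 1) ×ˢ Icc (n : ℝ≥0) (n + 1)) := by
  rintro ⟨u, v⟩ ⟨hu, hv⟩
  rcases frac_cases hu with ⟨a1, a2⟩ | ⟨a1, a2, a3⟩ <;>
  rcases frac_cases hv with ⟨b1, b2⟩ | ⟨b1, b2, b3⟩ <;>
  simp_all [bilinExtend]

theorem continuous_bilinExtend {d : ℕ} (Y : ℕ → ℕ → E d) : Continuous (bilinExtend Y) := by
  refine LocallyFinite.continuous
    (f := fun i : ℕ × ℕ => Icc (i.1 : ℝ≥0) (i.1 + 1) ×ˢ Icc (i.2 : ℝ≥0) (i.2 + 1)) ?_ ?_ ?_ ?_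
  · rintro ⟨u, v⟩
    refine ⟨Iio (u + 1) ×ˢ Iio (v + 1), (isOpen_Iio.prod isOpen_Iio).mem_nhds ?_, ?_⟩
    · simp
    · refine ((finite_Iic (⌊u + 1⌋₊)).prod (finite_Iic (⌊v + 1⌋₊))).subset ?_
      rintro ⟨m, n⟩ ⟨⟨a, b⟩, ⟨h1, h2⟩, h3, h4⟩
      exact ⟨Nat.le_floor (h1.1.trans (le_of_lt h3)), Nat.le_floor (h2.1.trans (le_of_lt h4))⟩
  · refine eq_univ_of_forall fun p => mem_iUnion.2 ⟨(⌊p.1⌋₊, ⌊p.2⌋₊), ?_, ?_⟩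
    · exact ⟨Nat.floor_le bot_le, (Nat.lt_floor_add_one _).le⟩
    · exact ⟨Nat.floor_le bot_le, (Nat.lt_floor_add_one _).le⟩
  · exact fun i => isClosed_Icc.prod isClosed_Icc
  · intro i
    refine ContinuousOn.congr (Continuous.continuousOn ?_) (bilinExtend_eqOn Y i.1 i.2)
    fun_prop

/-- The numerical approximation `Φ_N(φp, φm)` with mesh size `2^{-N}`. -/
def numericalScheme {d : ℕ} (N : ℕ) (φp φm : X₁ d) : C₂ d where
  toFun p :=
    bilinExtend (discreteWaveMap (fun m => (φp ((m : ℝ≥0) / 2 ^ N) : E d))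
      (fun n => (φm ((n : ℝ≥0) / 2 ^ N) : E d))) (2 ^ N * p.1, 2 ^ N * p.2)
  continuous_toFun := (continuous_bilinExtend _).comp (by fun_prop)

/-! ### Solutions for random boundary data -/

/-- The random field `φ` on `(Ω', P')` is a solution with random boundary data `φp`, `φm` on
`(Ω, P)`: along some increasing sequence of mesh sizes `2^{-N_k}`, the numerical approximations
converge to `φ` in distribution. -/
structure IsSolution {d : ℕ} {Ω Ω' : Type*} [MeasurableSpace Ω] [MeasurableSpace Ω']
    (P : Measure Ω) [IsProbabilityMeasure P] (φp φm : Ω → X₁ d)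
    (P' : Measure Ω') [IsProbabilityMeasure P'] (φ : Ω' → X₂ d) : Prop where
  aemeasurable : AEMeasurable φ P'
  exists_tendsto : ∃ N : ℕ → ℕ, StrictMono N ∧
    TendstoInDistribution (fun k ω => numericalScheme (N k) (φp ω) (φm ω)) atTop
      (fun ω' => incl (φ ω')) (fun _ => P) P'

end WaveMaps

end

/-! The equation reads `∂_u ∂_v φ = -(∂_u φ · ∂_v φ) φ`. A unit vector field is orthogonal to its
derivatives, so `|∂_u φ|` is independent of `v` and `|∂_v φ|` is independent of `u`: a wave map
inherits the speeds of its boundary data. The scheme obeys this law exactly, because the reflection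
in the line through `A + B` is an isometry exchanging the unit vectors `A` and `B`, so that opposite
sides of a cell have equal lengths.

Smooth and discrete fields are treated by one notion, `RectControl P Q f`: increments of `f` are
dominated by those of `P` and `Q`, and the mixed difference over any rectangle is minus the inner
product of the two sides at the lower left corner times the value there, up to a third-order error.
In the application `P` and `Q` are the arc lengths of the boundary data.

Three facts carry the proof. Discrete wave maps are controlled, with constants independent of the
mesh (`RectControl.discreteWaveMap`). Two controlled discrete fields with equal boundary values
differ by at most the largest increment of `P`, `Q` over a mesh step times an exponential, by a
Gronwall argument (`RectControl.norm_field_sub_le`); hence the scheme converges to a controlled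
field, and it converges to every controlled field with the given boundary data. For absolutely
continuous data, controlled fields with these boundary values are wave maps
(`RectControl.isWaveMap`) and wave maps are controlled (`IsWaveMap.rectControl`). Existence,
uniqueness and convergence of the whole sequence come out together.

The probabilistic part is then soft: almost sure convergence yields measurability of the limit and
convergence in law, and limits in law along a subsequence are unique. -/

noncomputable section

namespace WaveMaps

/-! ### Fields controlled on rectangles -/

/-- A field of unit vectors on a product of preorders whose increments are dominated by those of
`P` and `Q`, and whose mixed second differences satisfy the wave map equation up to third order. -/
structure RectControl {ι : Type*} [Preorder ι] {d : ℕ} (P Q : ι → ℝ) (f : ι → ι → E d) :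
    Prop where
  norm_eq_one : ∀ u v, ‖f u v‖ = 1
  left : ∀ ⦃u u'⦄, u ≤ u' → ∀ v, ‖f u' v - f u v‖ ≤ P u' - P u
  right : ∀ u ⦃v v'⦄, v ≤ v' → ‖f u v' - f u v‖ ≤ Q v' - Q v
  box : ∀ ⦃u u'⦄, u ≤ u' → ∀ ⦃v v'⦄, v ≤ v' →
    ‖f u' v' - f u' v - f u v' + f u v‖ ≤ 17 * (P u' - P u) * (Q v' - Q v)
  box_add : ∀ ⦃u u'⦄, u ≤ u' → ∀ ⦃v v'⦄, v ≤ v' →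
    ‖f u' v' - f u' v - f u v' + f u v + inner ℝ (f u' v - f u v) (f u v' - f u v) • f u v‖ ≤
      22 * (P u' - P u) * (Q v' - Q v) * ((P u' - P u) + (Q v' - Q v))

namespace RectControl

variable {ι κ : Type*} [Preorder ι] [Preorder κ] {d : ℕ} {P Q : ι → ℝ} {f : ι → ι → E d}

/-- Monotone maps send rectangles to rectangles. This serves for sampling on a grid, for rounding
down to a grid, and for extending fields from `ℝ≥0` to `ℝ`. -/
theorem comp (h : RectControl P Q f) {g : κ → ι} (hg : Monotone g) :
    RectControl (P ∘ g) (Q ∘ g) (fun u v => f (g u) (g v)) where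
  norm_eq_one _ _ := h.norm_eq_one _ _
  left _ _ hu _ := h.left (hg hu) _
  right _ _ _ hv := h.right _ (hg hv)
  box _ _ hu _ _ hv := h.box (hg hu) (hg hv)
  box_add _ _ hu _ _ hv := h.box_add (hg hu) (hg hv)

/-- All five conditions are closed under pointwise convergence, since no derivative occurs in them;
this brings the control from the scheme to its limit. -/
theorem of_tendsto {P' Q' : ℕ → ι → ℝ} {f' : ℕ → ι → ι → E d}
    (h : ∀ k, RectControl (P' k) (Q' k) (f' k))
    (hP : ∀ u, Tendsto (fun k => P' k u) atTop (𝓝 (P u)))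
    (hQ : ∀ u, Tendsto (fun k => Q' k u) atTop (𝓝 (Q u)))
    (hf : ∀ u v, Tendsto (fun k => f' k u v) atTop (𝓝 (f u v))) : RectControl P Q f where
  norm_eq_one u v :=
    tendsto_nhds_unique (hf u v).norm (by simp [(h _).norm_eq_one])
  left u u' hu v := le_of_tendsto_of_tendsto' ((hf u' v).sub (hf u v)).norm
    ((hP u').sub (hP u)) fun k => (h k).left hu v
  right u v v' hv := le_of_tendsto_of_tendsto' ((hf u v').sub (hf u v)).norm
    ((hQ v').sub (hQ v)) fun k => (h k).right u hv
  box u u' hu v v' hv := le_of_tendsto_of_tendsto'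
    ((((hf u' v').sub (hf u' v)).sub (hf u v')).add (hf u v)).norm
    ((((hP u').sub (hP u)).const_mul 17).mul ((hQ v').sub (hQ v))) fun k => (h k).box hu hv
  box_add u u' hu v v' hv := le_of_tendsto_of_tendsto'
    (((((hf u' v').sub (hf u' v)).sub (hf u v')).add (hf u v)).add
      ((((hf u' v).sub (hf u v)).inner ((hf u v').sub (hf u v))).smul (hf u v))).norm
    (((((hP u').sub (hP u)).const_mul 22).mul ((hQ v').sub (hQ v))).mul
      (((hP u').sub (hP u)).add ((hQ v').sub (hQ v)))) fun k => (h k).box_add hu hv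

theorem monotone_left (h : RectControl P Q f) : Monotone P := fun u _ hu =>
  sub_nonneg.1 ((norm_nonneg _).trans (h.left hu u))

theorem monotone_right (h : RectControl P Q f) : Monotone Q := fun v _ hv =>
  sub_nonneg.1 ((norm_nonneg _).trans (h.right v hv))

end RectControl

/-- Summation of mixed second differences over a rectangle. -/
theorem norm_box_le_of_cell {F : Type*} [SeminormedAddCommGroup F] {T : ℕ → ℕ → F} {P Q : ℕ → ℝ}
    {c : ℝ} {m n M N : ℕ} (hm : m ≤ M) (hn : n ≤ N)
    (h : ∀ i j, m ≤ i → i < M → n ≤ j → j < N →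
      ‖T (i + 1) (j + 1) - T (i + 1) j - T i (j + 1) + T i j‖ ≤
        c * (P (i + 1) - P i) * (Q (j + 1) - Q j)) :
    ‖T M N - T M n - T m N + T m n‖ ≤ c * (P M - P m) * (Q N - Q n) := by
  have row : ∀ i, m ≤ i → i < M → ∀ N', n ≤ N' → N' ≤ N →
      ‖T (i + 1) N' - T (i + 1) n - T i N' + T i n‖ ≤ c * (P (i + 1) - P i) * (Q N' - Q n) := by
    intro i hi hiM N' hN'
    induction N', hN' using Nat.le_induction with
    | base => intro _; simp
    | succ k hk ih =>
      intro hkN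
      have h1 := ih (by omega)
      have h2 := h i k hi hiM hk (by omega)
      have : T (i + 1) (k + 1) - T (i + 1) n - T i (k + 1) + T i n =
          (T (i + 1) k - T (i + 1) n - T i k + T i n) +
          (T (i + 1) (k + 1) - T (i + 1) k - T i (k + 1) + T i k) := by abel
      rw [this]
      refine (norm_add_le _ _).trans ?_
      linarith
  have : ∀ M', m ≤ M' → M' ≤ M →
      ‖T M' N - T M' n - T m N + T m n‖ ≤ c * (P M' - P m) * (Q N - Q n) := by
    intro M' hM'
    induction M', hM' using Nat.le_induction with
    | base => intro _; simp
    | succ k hk ih =>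
      intro hkM
      have h1 := ih (by omega)
      have h2 := row k hk (by omega) N hn le_rfl
      have : T (k + 1) N - T (k + 1) n - T m N + T m n =
          (T k N - T k n - T m N + T m n) +
          (T (k + 1) N - T (k + 1) n - T k N + T k n) := by abel
      rw [this]
      refine (norm_add_le _ _).trans ?_
      linarith
  exact this M hm le_rfl

theorem norm_inner_smul_le {F : Type*} [NormedAddCommGroup F] [InnerProductSpace ℝ F]
    {a b x : F} {r s t : ℝ} (ha : ‖a‖ ≤ r) (hb : ‖b‖ ≤ s) (hx : ‖x‖ ≤ t) :
    ‖inner ℝ a b • x‖ ≤ r * s * t := by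
  rw [norm_smul]
  have ha0 := (norm_nonneg a).trans ha
  gcongr
  · exact mul_nonneg ha0 ((norm_nonneg b).trans hb)
  · exact (norm_inner_le_norm (𝕜 := ℝ) a b).trans (by gcongr)

/-- Cellwise control of a discrete field implies control on all rectangles. -/
theorem RectControl.of_cell {d : ℕ} {P Q : ℕ → ℝ} {Y : ℕ → ℕ → E d}
    (hnorm : ∀ m n, ‖Y m n‖ = 1)
    (hleft : ∀ m n, ‖Y (m + 1) n - Y m n‖ ≤ P (m + 1) - P m)
    (hright : ∀ m n, ‖Y m (n + 1) - Y m n‖ ≤ Q (n + 1) - Q n)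
    (hbox : ∀ m n, ‖Y (m + 1) (n + 1) - Y (m + 1) n - Y m (n + 1) + Y m n‖ ≤
      17 * (P (m + 1) - P m) * (Q (n + 1) - Q n))
    (hadd : ∀ m n, ‖Y (m + 1) (n + 1) - Y (m + 1) n - Y m (n + 1) + Y m n
        + inner ℝ (Y (m + 1) n - Y m n) (Y m (n + 1) - Y m n) • Y m n‖ ≤
      4 * (P (m + 1) - P m) * (Q (n + 1) - Q n) * ((P (m + 1) - P m) + (Q (n + 1) - Q n))) :
    RectControl P Q Y := by
  have monoP : Monotone P := monotone_nat_of_le_succ fun m =>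
    sub_nonneg.1 ((norm_nonneg _).trans (hleft m 0))
  have monoQ : Monotone Q := monotone_nat_of_le_succ fun m =>
    sub_nonneg.1 ((norm_nonneg _).trans (hright 0 m))
  have left : ∀ ⦃u u'⦄, u ≤ u' → ∀ v, ‖Y u' v - Y u v‖ ≤ P u' - P u := by
    intro u u' hu v
    induction u', hu using Nat.le_induction with
    | base => simp
    | succ k hk ih =>
      rw [← sub_add_sub_cancel _ (Y k v)]
      refine (norm_add_le _ _).trans ?_
      linarith [hleft k v]
  have right : ∀ u ⦃v v'⦄, v ≤ v' → ‖Y u v' - Y u v‖ ≤ Q v' - Q v := by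
    intro u v v' hv
    induction v', hv using Nat.le_induction with
    | base => simp
    | succ k hk ih =>
      rw [← sub_add_sub_cancel _ (Y u k)]
      refine (norm_add_le _ _).trans ?_
      linarith [hright u k]
  have box : ∀ ⦃u u'⦄, u ≤ u' → ∀ ⦃v v'⦄, v ≤ v' →
      ‖Y u' v' - Y u' v - Y u v' + Y u v‖ ≤ 17 * (P u' - P u) * (Q v' - Q v) :=
    fun u u' hu v v' hv => norm_box_le_of_cell hu hv fun i j _ _ _ _ => hbox i j
  refine ⟨hnorm, left, right, box, ?_⟩
  intro m M hm n N hn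
  -- The added product vanishes on the sides `i = m` and `j = n`, so the mixed difference of this
  -- `T` over the whole rectangle is the corrected one for `Y`, and it can be summed over cells.
  have key := norm_box_le_of_cell (T := fun i j => Y i j
    + inner ℝ (Y i n - Y m n) (Y m j - Y m n) • Y m n) (P := P) (Q := Q)
    (c := 22 * ((P M - P m) + (Q N - Q n))) hm hn ?_
  · refine le_of_eq_of_le ?_ (key.trans_eq (by ring))
    congr 1
    simp
    abel
  intro i j hmi hiM hnj hjN
  -- The product in a cell uses the sides of that cell, the one in `T` their translates to the sides
  -- of the rectangle. Moving each of the two sides costs 17, moving the base point costs 1, and the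
  -- cell itself costs 4: together 22.
  have e : (Y (i + 1) (j + 1) + inner ℝ (Y (i + 1) n - Y m n) (Y m (j + 1) - Y m n) • Y m n)
      - (Y (i + 1) j + inner ℝ (Y (i + 1) n - Y m n) (Y m j - Y m n) • Y m n)
      - (Y i (j + 1) + inner ℝ (Y i n - Y m n) (Y m (j + 1) - Y m n) • Y m n)
      + (Y i j + inner ℝ (Y i n - Y m n) (Y m j - Y m n) • Y m n)
      = (Y (i + 1) (j + 1) - Y (i + 1) j - Y i (j + 1) + Y i j
        + inner ℝ (Y (i + 1) j - Y i j) (Y i (j + 1) - Y i j) • Y i j)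
      - inner ℝ (Y (i + 1) j - Y (i + 1) n - Y i j + Y i n) (Y i (j + 1) - Y i j) • Y i j
      - inner ℝ (Y (i + 1) n - Y i n)
          (Y i (j + 1) - Y i j - Y m (j + 1) + Y m j) • Y i j
      - inner ℝ (Y (i + 1) n - Y i n) (Y m (j + 1) - Y m j) • ((Y i j - Y m j) + (Y m j - Y m n))
      := by
    simp only [inner_sub_left, inner_sub_right, inner_add_left, inner_add_right]
    module
  have p0 : 0 ≤ P (i + 1) - P i := sub_nonneg.2 (monoP (by omega))
  have q0 : 0 ≤ Q (j + 1) - Q j := sub_nonneg.2 (monoQ (by omega))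
  have p1 : P (i + 1) - P i ≤ P M - P m := by
    linarith [monoP hmi, monoP (show i + 1 ≤ M by omega)]
  have q1 : Q (j + 1) - Q j ≤ Q N - Q n := by
    linarith [monoQ hnj, monoQ (show j + 1 ≤ N by omega)]
  have p2 : P i - P m ≤ P M - P m := by linarith [monoP hiM.le]
  have q2 : Q j - Q n ≤ Q N - Q n := by linarith [monoQ hjN.le]
  have e1 := hadd i j
  have e2 := norm_inner_smul_le (box (Nat.le_succ i) hnj) (hright i j) (hnorm i j).le
  have e3 := norm_inner_smul_le (b := Y i (j + 1) - Y i j - Y m (j + 1) + Y m j)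
    (s := 17 * (P i - P m) * (Q (j + 1) - Q j)) (hleft i n) (box hmi (Nat.le_succ j)) (hnorm i j).le
  have e4 := norm_inner_smul_le (hleft i n) (hright m j)
    ((norm_add_le _ _).trans (add_le_add (left hmi j) (right m hnj)))
  rw [e]
  refine (norm_sub_le _ _).trans ((add_le_add ((norm_sub_le _ _).trans (add_le_add
    ((norm_sub_le _ _).trans (add_le_add e1 e2)) e3)) e4).trans ?_)
  generalize P (i + 1) - P i = p at *
  generalize Q (j + 1) - Q j = q at *
  have hpq : 0 ≤ p * q := mul_nonneg p0 q0
  nlinarith [mul_le_mul_of_nonneg_left p1 hpq, mul_le_mul_of_nonneg_left q1 hpq,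
    mul_le_mul_of_nonneg_left p2 hpq, mul_le_mul_of_nonneg_left q2 hpq]

/-! ### The reflection and the discrete scheme -/

section Reflection

variable {d : ℕ}

theorem norm_lineReflection (Q x : E d) : ‖lineReflection Q x‖ = ‖x‖ := by
  rcases eq_or_ne Q 0 with rfl | hQ
  · simp [lineReflection]
  have h : ‖Q‖ ≠ 0 := norm_ne_zero_iff.2 hQ
  rw [← sq_eq_sq₀ (norm_nonneg _) (norm_nonneg _), lineReflection, norm_sub_sq_real, norm_smul,
    inner_smul_left, mul_pow, Real.norm_eq_abs, sq_abs]
  simp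
  field_simp
  ring

theorem lineReflection_sub (Q x y : E d) :
    lineReflection Q (x - y) = lineReflection Q x - lineReflection Q y := by
  simp only [lineReflection, inner_sub_right]
  module

/-- `A + B` spans the bisector of two vectors of equal norm. In the antipodal case the reflection is
`P ↦ -P`, which still exchanges them; this is why the scheme needs no smallness of its steps. -/
theorem lineReflection_add_right {A B : E d} (h : ‖A‖ = ‖B‖) : lineReflection (A + B) B = A := by
  rcases eq_or_ne (A + B) 0 with h0 | h0
  · rw [h0, eq_neg_of_add_eq_zero_left h0]
    simp [lineReflection]
  have h1 : ‖A + B‖ ^ 2 ≠ 0 := pow_ne_zero _ (norm_ne_zero_iff.2 h0)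
  have h2 : 2 * inner ℝ (A + B) B = ‖A + B‖ ^ 2 := by
    rw [norm_add_sq_real, inner_add_left, real_inner_self_eq_norm_sq, h]
    ring
  have h3 : 2 * (‖A + B‖ ^ 2)⁻¹ * inner ℝ (A + B) B = 1 := by
    rw [mul_right_comm, h2, mul_inv_cancel₀ h1]
  rw [lineReflection, h3]
  module

theorem lineReflection_add_left {A B : E d} (h : ‖A‖ = ‖B‖) : lineReflection (A + B) A = B := by
  rw [add_comm]
  exact lineReflection_add_right h.symm

theorem norm_lineReflection_sub_left {A B : E d} (h : ‖A‖ = ‖B‖) (p : E d) :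
    ‖lineReflection (A + B) p - A‖ = ‖B - p‖ := by
  have := norm_lineReflection (A + B) (p - B)
  rwa [lineReflection_sub, lineReflection_add_right h, norm_sub_rev p B] at this

theorem norm_lineReflection_sub_right {A B : E d} (h : ‖A‖ = ‖B‖) (p : E d) :
    ‖lineReflection (A + B) p - B‖ = ‖A - p‖ := by
  have := norm_lineReflection (A + B) (p - A)
  rwa [lineReflection_sub, lineReflection_add_left h, norm_sub_rev p A] at this

theorem two_mul_inner_add_sub_sq {A B p : E d} (hA : ‖A‖ = 1) (hB : ‖B‖ = 1) (hp : ‖p‖ = 1) :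
    2 * inner ℝ (A + B) p - ‖A + B‖ ^ 2 = -2 * inner ℝ (A - p) (B - p) := by
  rw [norm_add_sq_real]
  simp only [inner_add_left, inner_sub_left, inner_sub_right, real_inner_self_eq_norm_sq, hA, hB,
    hp, real_inner_comm p B]
  ring

/-- The coefficient of `A + B` on the left is `2 |A + B|⁻² ((A + B) · p) - 1`, and for unit vectors
its numerator is `-2 (A - p) · (B - p)`. When `A + B = 0` both sides vanish. -/
theorem lineReflection_box {A B p : E d} (hA : ‖A‖ = 1) (hB : ‖B‖ = 1) (hp : ‖p‖ = 1) :
    lineReflection (A + B) p - A - B + p =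
      -(2 * (‖A + B‖ ^ 2)⁻¹ * inner ℝ (A - p) (B - p)) • (A + B) := by
  rcases eq_or_ne (A + B) 0 with h0 | h0
  · rw [eq_neg_of_add_eq_zero_left h0]
    simp [lineReflection]
  have h1 : ‖A + B‖ ^ 2 ≠ 0 := pow_ne_zero _ (norm_ne_zero_iff.2 h0)
  have h2 : 2 * (‖A + B‖ ^ 2)⁻¹ * inner ℝ (A + B) p =
      1 - 2 * (‖A + B‖ ^ 2)⁻¹ * inner ℝ (A - p) (B - p) := by
    have := two_mul_inner_add_sub_sq hA hB hp
    field_simp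
    linarith
  rw [lineReflection, h2]
  module

/-- Unless `A` and `B` are nearly antipodal, the exact formula for the mixed difference applies,
with `2 |A + B|⁻² (A + B)` close to `p`. Near the antipodal position the sides are long, and the
crude bound by the length of the shorter side is already of third order. -/
theorem norm_lineReflection_box_add_le {A B p : E d} (hA : ‖A‖ = 1) (hB : ‖B‖ = 1)
    (hp : ‖p‖ = 1) :
    ‖lineReflection (A + B) p - A - B + p + inner ℝ (A - p) (B - p) • p‖ ≤
      4 * ‖A - p‖ * ‖B - p‖ * (‖A - p‖ + ‖B - p‖) := by
  set a := ‖A - p‖ with ha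
  set b := ‖B - p‖ with hb
  have a0 : 0 ≤ a := norm_nonneg _
  have b0 : 0 ≤ b := norm_nonneg _
  have hin : |inner ℝ (A - p) (B - p)| ≤ a * b := abs_real_inner_le_norm _ _
  have hAB : ‖A - B‖ ≤ a + b := by
    rw [← sub_sub_sub_cancel_right A B p]
    exact norm_sub_le _ _
  have par : ‖A + B‖ ^ 2 = 4 - ‖A - B‖ ^ 2 := by
    rw [norm_add_sq_real, norm_sub_sq_real, hA, hB]
    ring
  have hAB2 : ‖A - B‖ ≤ 2 := (norm_sub_le _ _).trans (by rw [hA, hB]; norm_num)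
  rcases le_or_gt 1 (‖A + B‖ ^ 2) with h | h
  · have h0 : ‖A + B‖ ^ 2 ≠ 0 := by positivity
    have e : lineReflection (A + B) p - A - B + p + inner ℝ (A - p) (B - p) • p =
        (-(inner ℝ (A - p) (B - p) * (‖A + B‖ ^ 2)⁻¹)) •
          ((2 : ℝ) • ((A - p) + (B - p)) + ‖A - B‖ ^ 2 • p) := by
      rw [lineReflection_box hA hB hp]
      have : inner ℝ (A - p) (B - p) • p =
          (inner ℝ (A - p) (B - p) * (‖A + B‖ ^ 2)⁻¹ * (4 - ‖A - B‖ ^ 2)) • p := by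
        rw [← par, inv_mul_cancel_right₀ h0]
      rw [this]
      module
    have n1 : ‖(2 : ℝ) • ((A - p) + (B - p)) + ‖A - B‖ ^ 2 • p‖ ≤ 4 * (a + b) := by
      refine (norm_add_le _ _).trans ?_
      rw [norm_smul, norm_smul, hp]
      have := norm_add_le (A - p) (B - p)
      simp only [Real.norm_ofNat, norm_pow, norm_norm, mul_one]
      nlinarith [norm_nonneg (A - B)]
    rw [e, norm_smul, norm_neg, norm_mul, Real.norm_eq_abs, norm_inv]
    have n2 : ‖‖A + B‖ ^ 2‖⁻¹ ≤ 1 := by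
      rw [Real.norm_of_nonneg (by positivity)]
      exact inv_le_one_of_one_le₀ h
    calc |inner ℝ (A - p) (B - p)| * ‖‖A + B‖ ^ 2‖⁻¹ *
          ‖(2 : ℝ) • ((A - p) + (B - p)) + ‖A - B‖ ^ 2 • p‖
        ≤ (a * b) * 1 * (4 * (a + b)) := by gcongr
      _ = _ := by ring
  -- Here `|A - B|² > 3`, hence `a + b` exceeds `√3`. With twice the shorter side bounding the mixed
  -- difference, `3 a b (a + b)` dominates it; the product term uses up the remaining unit of the
  -- constant 4.
  · have s3 : 3 < (a + b) ^ 2 := by nlinarith [norm_nonneg (A - B)]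
    have s1 : 1 ≤ a + b := by nlinarith
    have hZ1 : ‖lineReflection (A + B) p - A - B + p‖ ≤ 2 * b := by
      have e : lineReflection (A + B) p - A - B + p =
        (lineReflection (A + B) p - A) - (B - p) := by abel
      rw [e]
      refine (norm_sub_le _ _).trans ?_
      rw [norm_lineReflection_sub_left (hA.trans hB.symm)]
      linarith
    have hZ2 : ‖lineReflection (A + B) p - A - B + p‖ ≤ 2 * a := by
      have e : lineReflection (A + B) p - A - B + p =
        (lineReflection (A + B) p - B) - (A - p) := by abel
      rw [e]
      refine (norm_sub_le _ _).trans ?_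
      rw [norm_lineReflection_sub_right (hA.trans hB.symm)]
      linarith
    refine (norm_add_le _ _).trans ?_
    rw [norm_smul, hp, mul_one, Real.norm_eq_abs]
    have hab : a * b ≤ a * b * (a + b) := le_mul_of_one_le_right (by positivity) s1
    have : ‖lineReflection (A + B) p - A - B + p‖ ≤ 3 * (a * b * (a + b)) := by
      rcases le_total a b with hle | hle
      · have : 1 ≤ 3 / 2 * (b * (a + b)) := by nlinarith
        nlinarith
      · have : 1 ≤ 3 / 2 * (a * (a + b)) := by nlinarith
        nlinarith
    linarith

/-- Sides have length at most 2, so `4 (a + b) + 1 ≤ 17`. -/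
theorem norm_lineReflection_box_le {A B p : E d} (hA : ‖A‖ = 1) (hB : ‖B‖ = 1) (hp : ‖p‖ = 1) :
    ‖lineReflection (A + B) p - A - B + p‖ ≤ 17 * ‖A - p‖ * ‖B - p‖ := by
  have h := norm_lineReflection_box_add_le hA hB hp
  have hin : |inner ℝ (A - p) (B - p)| ≤ ‖A - p‖ * ‖B - p‖ := abs_real_inner_le_norm _ _
  have ha : ‖A - p‖ ≤ 2 := (norm_sub_le _ _).trans (by rw [hA, hp]; norm_num)
  have hb : ‖B - p‖ ≤ 2 := (norm_sub_le _ _).trans (by rw [hB, hp]; norm_num)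
  have e : lineReflection (A + B) p - A - B + p =
    (lineReflection (A + B) p - A - B + p + inner ℝ (A - p) (B - p) • p)
      - inner ℝ (A - p) (B - p) • p := by abel
  rw [e]
  refine (norm_sub_le _ _).trans ?_
  rw [norm_smul, hp, mul_one, Real.norm_eq_abs]
  have : 0 ≤ ‖A - p‖ * ‖B - p‖ := by positivity
  nlinarith

variable {Yp Ym : ℕ → E d}

@[simp]
theorem discreteWaveMap_zero_right (m : ℕ) : discreteWaveMap Yp Ym m 0 = Yp m := by
  rw [discreteWaveMap]

theorem discreteWaveMap_zero_left (h : Ym 0 = Yp 0) (n : ℕ) :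
    discreteWaveMap Yp Ym 0 n = Ym n := by
  cases n <;> simp [discreteWaveMap, h]

theorem discreteWaveMap_succ_succ (m n : ℕ) : discreteWaveMap Yp Ym (m + 1) (n + 1) =
    lineReflection (discreteWaveMap Yp Ym (m + 1) n + discreteWaveMap Yp Ym m (n + 1))
      (discreteWaveMap Yp Ym m n) := by
  rw [discreteWaveMap]

theorem norm_discreteWaveMap (hp : ∀ m, ‖Yp m‖ = 1) (hm : ∀ n, ‖Ym n‖ = 1) (m n : ℕ) :
    ‖discreteWaveMap Yp Ym m n‖ = 1 := by
  induction n generalizing m with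
  | zero => simp [hp]
  | succ n ih =>
    cases m with
    | zero => simp [discreteWaveMap, hm]
    | succ m => rw [discreteWaveMap_succ_succ, norm_lineReflection, ih]

/-- The discrete conservation law: each reflection maps one side of a cell to the opposite one, so
lengths are transported from the boundary unchanged. -/
theorem norm_discreteWaveMap_left (hp : ∀ m, ‖Yp m‖ = 1) (hm : ∀ n, ‖Ym n‖ = 1) (m n : ℕ) :
    ‖discreteWaveMap Yp Ym (m + 1) n - discreteWaveMap Yp Ym m n‖ = ‖Yp (m + 1) - Yp m‖ := by
  induction n with
  | zero => simp
  | succ n ih =>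
    rw [discreteWaveMap_succ_succ, norm_lineReflection_sub_right
      (by rw [norm_discreteWaveMap hp hm, norm_discreteWaveMap hp hm]), ih]

theorem norm_discreteWaveMap_right (hp : ∀ m, ‖Yp m‖ = 1) (hm : ∀ n, ‖Ym n‖ = 1)
    (h0 : Ym 0 = Yp 0) (m n : ℕ) :
    ‖discreteWaveMap Yp Ym m (n + 1) - discreteWaveMap Yp Ym m n‖ = ‖Ym (n + 1) - Ym n‖ := by
  induction m with
  | zero => rw [discreteWaveMap_zero_left h0, discreteWaveMap_zero_left h0]
  | succ m ih =>
    rw [discreteWaveMap_succ_succ, norm_lineReflection_sub_left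
      (by rw [norm_discreteWaveMap hp hm, norm_discreteWaveMap hp hm]), ih]

theorem RectControl.discreteWaveMap {P Q : ℕ → ℝ} (hp : ∀ m, ‖Yp m‖ = 1) (hm : ∀ n, ‖Ym n‖ = 1)
    (h0 : Ym 0 = Yp 0) (hP : ∀ m, ‖Yp (m + 1) - Yp m‖ ≤ P (m + 1) - P m)
    (hQ : ∀ n, ‖Ym (n + 1) - Ym n‖ ≤ Q (n + 1) - Q n) :
    RectControl P Q (discreteWaveMap Yp Ym) := by
  have l := fun m n => (norm_discreteWaveMap_left hp hm m n).trans_le (hP m)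
  have r := fun m n => (norm_discreteWaveMap_right hp hm h0 m n).trans_le (hQ n)
  have N := norm_discreteWaveMap hp hm
  refine .of_cell N l r (fun m n => ?_) (fun m n => ?_)
  · rw [discreteWaveMap_succ_succ]
    refine (norm_lineReflection_box_le (N _ _) (N _ _) (N _ _)).trans ?_
    have := (norm_nonneg _).trans (hP m)
    gcongr
    exacts [l m n, r m n]
  · rw [discreteWaveMap_succ_succ]
    refine (norm_lineReflection_box_add_le (N _ _) (N _ _) (N _ _)).trans ?_
    have := (norm_nonneg _).trans (hP m)
    have := (norm_nonneg _).trans (hQ n)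
    gcongr
    exacts [l m n, r m n, l m n, r m n]

end Reflection

/-! ### Stability and convergence of the scheme -/

/-- Two discrete fields with the same boundary values and the same control are close if the
mesh is fine with respect to the control. -/
theorem RectControl.norm_field_sub_le {d : ℕ} {P Q : ℕ → ℝ} {y z : ℕ → ℕ → E d}
    (hy : RectControl P Q y) (hz : RectControl P Q z) (h_left : ∀ n, y 0 n = z 0 n)
    (h_right : ∀ m, y m 0 = z m 0) {δ : ℝ} (hδ : 0 ≤ δ) {M N : ℕ}
    (hP : ∀ m < M, P (m + 1) - P m ≤ δ) (hQ : ∀ n < N, Q (n + 1) - Q n ≤ δ)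
    {m n : ℕ} (hm : m ≤ M) (hn : n ≤ N) :
    ‖y m n - z m n‖ ≤ δ * Real.exp (91 * ((P m - P 0) + (Q n - Q 0))) := by
  -- Gronwall weight. The rate is `91 = 2 · 44 + 3`: two local errors `22 p q (p + q) ≤ 44 p q X`,
  -- as `p, q ≤ δ ≤ X`, and three terms from the trilinear nonlinearity, each at most `p q X`.
  set X : ℕ → ℕ → ℝ := fun m n => δ * Real.exp (91 * ((P m - P 0) + (Q n - Q 0))) with hX
  have monoP := hy.monotone_left
  have monoQ := hy.monotone_right
  have X0 : ∀ m n, 0 ≤ X m n := fun m n => by positivity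
  have δX : ∀ m n, δ ≤ X m n := fun m n => le_mul_of_one_le_right hδ (Real.one_le_exp (by
    have := monoP (Nat.zero_le m)
    have := monoQ (Nat.zero_le n)
    linarith))
  have Xl : ∀ m n, X m n + 91 * (P (m + 1) - P m) * X m n ≤ X (m + 1) n := by
    intro m n
    have h1 := Real.add_one_le_exp (91 * (P (m + 1) - P m))
    have h2 : X (m + 1) n = X m n * Real.exp (91 * (P (m + 1) - P m)) := by
      simp only [hX]
      rw [mul_assoc, ← Real.exp_add]
      ring_nf
    rw [h2]
    nlinarith [X0 m n]
  have Xr : ∀ m n, X m n + 91 * (Q (n + 1) - Q n) * X m n ≤ X m (n + 1) := by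
    intro m n
    have h1 := Real.add_one_le_exp (91 * (Q (n + 1) - Q n))
    have h2 : X m (n + 1) = X m n * Real.exp (91 * (Q (n + 1) - Q n)) := by
      simp only [hX]
      rw [mul_assoc, ← Real.exp_add]
      ring_nf
    rw [h2]
    nlinarith [X0 m n]
  set D : ℕ → ℕ → E d := fun m n => y m n - z m n with hD
  have step : ∀ m n, m < M → n < N → ‖D m n‖ ≤ X m n →
      ‖D (m + 1) n - D m n‖ ≤ (P (m + 1) - P m) * X m n →
      ‖D m (n + 1) - D m n‖ ≤ (Q (n + 1) - Q n) * X m n →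
      ‖D (m + 1) (n + 1) - D (m + 1) n - D m (n + 1) + D m n‖ ≤
        91 * (P (m + 1) - P m) * (Q (n + 1) - Q n) * X m n := by
    intro m n hm hn h1 h2 h3
    have e : D (m + 1) (n + 1) - D (m + 1) n - D m (n + 1) + D m n =
        (y (m + 1) (n + 1) - y (m + 1) n - y m (n + 1) + y m n
          + inner ℝ (y (m + 1) n - y m n) (y m (n + 1) - y m n) • y m n)
        - (z (m + 1) (n + 1) - z (m + 1) n - z m (n + 1) + z m n
          + inner ℝ (z (m + 1) n - z m n) (z m (n + 1) - z m n) • z m n)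
        - inner ℝ (D (m + 1) n - D m n) (y m (n + 1) - y m n) • y m n
        - inner ℝ (z (m + 1) n - z m n) (D m (n + 1) - D m n) • y m n
        - inner ℝ (z (m + 1) n - z m n) (z m (n + 1) - z m n) • D m n := by
      simp only [hD, inner_sub_left, inner_sub_right]
      module
    have e1 := hy.box_add (Nat.le_succ m) (Nat.le_succ n)
    have e2 := hz.box_add (Nat.le_succ m) (Nat.le_succ n)
    have e3 := norm_inner_smul_le h2 (hy.right m (Nat.le_succ n)) (hy.norm_eq_one m n).le
    have e4 := norm_inner_smul_le (hz.left (Nat.le_succ m) n) h3 (hy.norm_eq_one m n).le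
    have e5 := norm_inner_smul_le (hz.left (Nat.le_succ m) n) (hz.right m (Nat.le_succ n)) h1
    rw [e]
    refine (norm_sub_le _ _).trans ((add_le_add ((norm_sub_le _ _).trans (add_le_add
      ((norm_sub_le _ _).trans (add_le_add ((norm_sub_le _ _).trans (add_le_add e1 e2)) e3))
      e4)) e5).trans ?_)
    simp only [Nat.succ_eq_add_one]
    have p0 : 0 ≤ P (m + 1) - P m := sub_nonneg.2 (monoP (by omega))
    have q0 : 0 ≤ Q (n + 1) - Q n := sub_nonneg.2 (monoQ (by omega))
    have p1 := (hP m hm).trans (δX m n)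
    have q1 := (hQ n hn).trans (δX m n)
    generalize P (m + 1) - P m = p at *
    generalize Q (n + 1) - Q n = q at *
    have hpq : 0 ≤ p * q := mul_nonneg p0 q0
    nlinarith [mul_le_mul_of_nonneg_left p1 hpq, mul_le_mul_of_nonneg_left q1 hpq]
  have stepA : ∀ m n, m < M → n < N → ‖D m n‖ ≤ X m n →
      ‖D (m + 1) n - D m n‖ ≤ (P (m + 1) - P m) * X m n →
      ‖D m (n + 1) - D m n‖ ≤ (Q (n + 1) - Q n) * X m n →
      ‖D (m + 1) (n + 1) - D m (n + 1)‖ ≤ (P (m + 1) - P m) * X m (n + 1) := by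
    intro m n hm hn h1 h2 h3
    have h4 := step m n hm hn h1 h2 h3
    have e : D (m + 1) (n + 1) - D m (n + 1) =
      (D (m + 1) n - D m n) + (D (m + 1) (n + 1) - D (m + 1) n - D m (n + 1) + D m n) := by abel
    rw [e]
    refine (norm_add_le _ _).trans ((add_le_add h2 h4).trans ?_)
    have p0 : 0 ≤ P (m + 1) - P m := sub_nonneg.2 (monoP (by omega))
    nlinarith [mul_le_mul_of_nonneg_left (Xr m n) p0]
  have stepB : ∀ m n, m < M → n < N → ‖D m n‖ ≤ X m n →
      ‖D (m + 1) n - D m n‖ ≤ (P (m + 1) - P m) * X m n →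
      ‖D m (n + 1) - D m n‖ ≤ (Q (n + 1) - Q n) * X m n →
      ‖D (m + 1) (n + 1) - D (m + 1) n‖ ≤ (Q (n + 1) - Q n) * X (m + 1) n := by
    intro m n hm hn h1 h2 h3
    have h4 := step m n hm hn h1 h2 h3
    have e : D (m + 1) (n + 1) - D (m + 1) n =
      (D m (n + 1) - D m n) + (D (m + 1) (n + 1) - D (m + 1) n - D m (n + 1) + D m n) := by abel
    rw [e]
    refine (norm_add_le _ _).trans ((add_le_add h3 h4).trans ?_)
    have q0 : 0 ≤ Q (n + 1) - Q n := sub_nonneg.2 (monoQ (by omega))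
    nlinarith [mul_le_mul_of_nonneg_left (Xl m n) q0]
  have D_l : ∀ n, D 0 n = 0 := fun n => sub_eq_zero.2 (h_left n)
  have D_r : ∀ m, D m 0 = 0 := fun m => sub_eq_zero.2 (h_right m)
  -- The difference and both of its increments are propagated together: `stepA` carries horizontal
  -- increments up one row, `stepB` carries vertical increments over one column, and the value
  -- follows by adding a horizontal increment.
  have main : ∀ n m, m ≤ M → n ≤ N → ‖D m n‖ ≤ X m n ∧
      (m < M → ‖D (m + 1) n - D m n‖ ≤ (P (m + 1) - P m) * X m n) ∧
      (n < N → ‖D m (n + 1) - D m n‖ ≤ (Q (n + 1) - Q n) * X m n) := by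
    intro n
    induction n with
    | zero =>
      have A : ∀ m, ‖D (m + 1) 0 - D m 0‖ ≤ (P (m + 1) - P m) * X m 0 := fun m => by
        rw [D_r, D_r, sub_zero, norm_zero]
        exact mul_nonneg (sub_nonneg.2 (monoP (by omega))) (X0 _ _)
      intro m
      induction m with
      | zero =>
        refine fun _ _ => ⟨by rw [D_r, norm_zero]; exact X0 _ _, fun _ => A 0, fun _ => ?_⟩
        rw [D_l, D_l, sub_zero, norm_zero]
        exact mul_nonneg (sub_nonneg.2 (monoQ (by omega))) (X0 _ _)
      | succ m ih =>
        intro hm hn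
        obtain ⟨i1, i2, i3⟩ := ih (by omega) hn
        exact ⟨by rw [D_r, norm_zero]; exact X0 _ _, fun _ => A _,
          fun h => stepB m 0 hm h i1 (i2 hm) (i3 h)⟩
    | succ n ihn =>
      intro m
      induction m with
      | zero =>
        intro hm hn
        obtain ⟨i1, i2, i3⟩ := ihn 0 hm (by omega)
        refine ⟨by rw [D_l, norm_zero]; exact X0 _ _,
          fun h => stepA 0 n h hn i1 (i2 h) (i3 hn), fun _ => ?_⟩
        rw [D_l, D_l, sub_zero, norm_zero]
        exact mul_nonneg (sub_nonneg.2 (monoQ (by omega))) (X0 _ _)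
      | succ m ih =>
        intro hm hn
        obtain ⟨i1, i2, i3⟩ := ih (by omega) hn
        obtain ⟨j1, j2, j3⟩ := ihn (m + 1) hm (by omega)
        refine ⟨?_, fun h => stepA (m + 1) n h hn j1 (j2 h) (j3 hn),
          fun h => stepB m (n + 1) hm h i1 (i2 hm) (i3 h)⟩
        rw [← sub_add_cancel (D (m + 1) (n + 1)) (D m (n + 1))]
        refine (norm_add_le _ _).trans ((add_le_add (i2 hm) i1).trans ?_)
        have p0 : 0 ≤ (P (m + 1) - P m) * X m (n + 1) :=
          mul_nonneg (sub_nonneg.2 (monoP (by omega))) (X0 _ _)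
        linarith [Xl m (n + 1)]
  exact (main n m hm hn).1

/-- The `k`-th dyadic point of mesh `2^{-N}`. -/
def dyadic (N k : ℕ) : ℝ≥0 := k / 2 ^ N

/-- The index of the last dyadic point of mesh `2^{-N}` below `u`. -/
def dyadicIndex (N : ℕ) (u : ℝ≥0) : ℕ := ⌊2 ^ N * u⌋₊

theorem monotone_dyadic (N : ℕ) : Monotone (dyadic N) := fun k l h => by
  unfold dyadic
  gcongr

theorem monotone_dyadicIndex (N : ℕ) : Monotone (dyadicIndex N) := fun u v h => by
  unfold dyadicIndex
  gcongr

@[simp]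
theorem dyadic_zero (N : ℕ) : dyadic N 0 = 0 := by simp [dyadic]

@[simp]
theorem dyadicIndex_zero (N : ℕ) : dyadicIndex N 0 = 0 := by simp [dyadicIndex]

theorem dyadic_succ (N k : ℕ) : dyadic N (k + 1) = dyadic N k + 1 / 2 ^ N := by
  simp [dyadic, add_div]

theorem dyadic_dyadicIndex_le (N : ℕ) (u : ℝ≥0) : dyadic N (dyadicIndex N u) ≤ u := by
  rw [dyadic, div_le_iff₀' (by positivity)]
  exact Nat.floor_le (by positivity)

theorem le_dyadic_dyadicIndex_succ (N : ℕ) (u : ℝ≥0) : u ≤ dyadic N (dyadicIndex N u + 1) := by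
  rw [dyadic, le_div_iff₀' (by positivity)]
  push_cast
  exact (Nat.lt_floor_add_one (2 ^ N * u)).le

/-- Dyadic grids are nested, so a coarse grid point is fixed by rounding to a finer grid. -/
theorem dyadic_dyadicIndex_dyadic {N M : ℕ} (h : N ≤ M) (k : ℕ) :
    dyadic M (dyadicIndex M (dyadic N k)) = dyadic N k := by
  have : (2 : ℝ≥0) ^ M * (k / 2 ^ N) = ((2 ^ (M - N) * k : ℕ) : ℝ≥0) := by
    obtain ⟨j, rfl⟩ := Nat.exists_eq_add_of_le h
    rw [pow_add, Nat.add_sub_cancel_left]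
    push_cast
    field_simp
  rw [dyadicIndex, dyadic, dyadic, this, Nat.floor_natCast, ← this]
  field_simp

theorem tendsto_dyadic_dyadicIndex (u : ℝ≥0) :
    Tendsto (fun N => dyadic N (dyadicIndex N u)) atTop (𝓝 u) := by
  have h : Tendsto (fun N : ℕ => u - 1 / 2 ^ N) atTop (𝓝 (u - 0)) := by
    refine tendsto_const_nhds.sub ?_
    simp_rw [← one_div_pow]
    exact tendsto_pow_atTop_nhds_zero_of_lt_one (by simp) (by
      rw [← NNReal.coe_lt_coe]; norm_num)
  rw [tsub_zero] at h
  refine tendsto_of_tendsto_of_tendsto_of_le_of_le h tendsto_const_nhds (fun N => ?_)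
    (fun N => dyadic_dyadicIndex_le N u)
  rw [tsub_le_iff_right, ← dyadic_succ]
  exact le_dyadic_dyadicIndex_succ N u

theorem eventually_increment_le {P : ℝ≥0 → ℝ} (hP : Continuous P) (R : ℝ≥0) {ε : ℝ} (hε : 0 < ε) :
    ∀ᶠ N : ℕ in atTop, ∀ x ≤ R, P (x + 1 / 2 ^ N) - P x ≤ ε := by
  have huc := (isCompact_Icc (a := (0 : ℝ≥0)) (b := R + 1)).uniformContinuousOn_of_continuous
    hP.continuousOn
  rw [Metric.uniformContinuousOn_iff] at huc
  obtain ⟨δ, hδ, h⟩ := huc ε hε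
  have ht : Tendsto (fun N : ℕ => ((1 / 2 : ℝ)) ^ N) atTop (𝓝 0) :=
    tendsto_pow_atTop_nhds_zero_of_lt_one (by norm_num) (by norm_num)
  filter_upwards [ht.eventually (gt_mem_nhds hδ)] with N hN x hx
  have h1 : (1 : ℝ≥0) / 2 ^ N ≤ 1 := by
    rw [div_le_one (by positivity)]
    exact one_le_pow₀ (by norm_num)
  have := h (x + 1 / 2 ^ N) ⟨zero_le, add_le_add hx h1⟩ x ⟨zero_le, hx.trans (by simp)⟩ (by
    rw [NNReal.dist_eq]
    push_cast
    rw [add_sub_cancel_left, abs_of_nonneg (by positivity), ← one_div_pow]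
    exact hN)
  rw [Real.dist_eq] at this
  exact (le_abs_self _).trans this.le

/-! ### Convergence of the scheme for boundary data with continuous control -/

section Convergence

variable {d : ℕ} {φp φm : X₁ d} {P Q : ℝ≥0 → ℝ}

/-- The discrete wave map at scale `2^{-N}` with boundary data sampled from `φp`, `φm`. -/
def schemeField (N : ℕ) (φp φm : X₁ d) : ℕ → ℕ → E d :=
  discreteWaveMap (fun m => (φp (dyadic N m) : E d)) (fun n => (φm (dyadic N n) : E d))

/-- The piecewise constant extension of the discrete wave map. -/
def floorField (N : ℕ) (φp φm : X₁ d) (u v : ℝ≥0) : E d :=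
  schemeField N φp φm (dyadicIndex N u) (dyadicIndex N v)

/-- `P` and `Q` dominate the increments of the compatible boundary data `φp`, `φm`. -/
structure BoundaryControl (P Q : ℝ≥0 → ℝ) (φp φm : X₁ d) : Prop where
  zero_eq : φm 0 = φp 0
  left : ∀ ⦃u u' : ℝ≥0⦄, u ≤ u' → ‖(φp u' : E d) - φp u‖ ≤ P u' - P u
  right : ∀ ⦃v v' : ℝ≥0⦄, v ≤ v' → ‖(φm v' : E d) - φm v‖ ≤ Q v' - Q v
  continuous_left : Continuous P
  continuous_right : Continuous Q

theorem BoundaryControl.rectControl_schemeField (h : BoundaryControl P Q φp φm) (N : ℕ) :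
    RectControl (P ∘ dyadic N) (Q ∘ dyadic N) (schemeField N φp φm) :=
  .discreteWaveMap (fun _ => by simp) (fun _ => by simp) (by simp [h.zero_eq])
    (fun _ => h.left (monotone_dyadic N (Nat.le_succ _)))
    (fun _ => h.right (monotone_dyadic N (Nat.le_succ _)))

theorem BoundaryControl.rectControl_floorField (h : BoundaryControl P Q φp φm) (N : ℕ) :
    RectControl (fun u => P (dyadic N (dyadicIndex N u))) (fun v => Q (dyadic N (dyadicIndex N v)))
      (floorField N φp φm) :=
  (h.rectControl_schemeField N).comp (monotone_dyadicIndex N)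

@[simp]
theorem schemeField_zero_right (N m : ℕ) : schemeField N φp φm m 0 = φp (dyadic N m) := by
  simp [schemeField]

theorem schemeField_zero_left (h : φm 0 = φp 0) (N n : ℕ) :
    schemeField N φp φm 0 n = φm (dyadic N n) := by
  rw [schemeField, discreteWaveMap_zero_left]
  simp [h]

/-- Comparison of the scheme with a field controlled on the dyadic points. -/
theorem BoundaryControl.norm_sub_schemeField_le (h : BoundaryControl P Q φp φm) {N : ℕ}
    {f : ℝ≥0 → ℝ≥0 → E d}
    (hf : RectControl (P ∘ dyadic N) (Q ∘ dyadic N) fun m n => f (dyadic N m) (dyadic N n))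
    (hfp : ∀ m, f (dyadic N m) 0 = φp (dyadic N m)) (hfm : ∀ n, f 0 (dyadic N n) = φm (dyadic N n))
    {R : ℝ≥0} {ε : ℝ} (hε : 0 ≤ ε) (hP : ∀ x ≤ R, P (x + 1 / 2 ^ N) - P x ≤ ε)
    (hQ : ∀ x ≤ R, Q (x + 1 / 2 ^ N) - Q x ≤ ε) {m n : ℕ}
    (hm : ∀ k < m, dyadic N k ≤ R) (hn : ∀ k < n, dyadic N k ≤ R) :
    ‖f (dyadic N m) (dyadic N n) - schemeField N φp φm m n‖ ≤
      ε * Real.exp (91 * ((P (dyadic N m) - P 0) + (Q (dyadic N n) - Q 0))) := by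
  have := hf.norm_field_sub_le (h.rectControl_schemeField N) (fun n => ?_) (fun m => ?_) hε
    (M := m) (N := n) (fun k hk => ?_) (fun k hk => ?_) le_rfl le_rfl
  · simpa using this
  · simp [hfm, schemeField_zero_left h.zero_eq]
  · simp [hfp]
  · simp only [Function.comp, dyadic_succ]
    exact hP _ (hm k hk)
  · simp only [Function.comp, dyadic_succ]
    exact hQ _ (hn k hk)

theorem dyadic_le_of_lt_dyadicIndex_succ {N k : ℕ} {u : ℝ≥0} (hk : k < dyadicIndex N u + 1) :
    dyadic N k ≤ u :=
  (monotone_dyadic N (Nat.lt_succ_iff.1 hk)).trans (dyadic_dyadicIndex_le N u)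

/-- The scheme at a finer level, sampled on the coarse grid, is no longer a discrete wave map, but
it is controlled with the same boundary values. This is where control on all rectangles, and not
only on cells, is needed. -/
theorem BoundaryControl.cauchySeq_floorField (h : BoundaryControl P Q φp φm) (u v : ℝ≥0) :
    CauchySeq fun N => floorField N φp φm u v := by
  have monoP : Monotone P := fun x y hxy => sub_nonneg.1 ((norm_nonneg _).trans (h.left hxy))
  have monoQ : Monotone Q := fun x y hxy => sub_nonneg.1 ((norm_nonneg _).trans (h.right hxy))
  rw [Metric.cauchySeq_iff']
  intro η hη
  set K := Real.exp (91 * ((P u - P 0) + (Q v - Q 0)))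
  have K0 : 0 < K := Real.exp_pos _
  -- `ε * K` bounds the distance of the two levels at the coarse grid point below `(u, v)`; `2 * ε`
  -- pays for moving there in both variables.
  obtain ⟨ε, ε0, hεη⟩ : ∃ ε : ℝ, 0 < ε ∧ ε * K + 2 * ε < η := by
    refine ⟨η / (2 * (K + 2)), by positivity, ?_⟩
    field_simp
    linarith
  obtain ⟨N, hNP, hNQ⟩ := ((eventually_increment_le h.continuous_left (max u v) ε0).and
    (eventually_increment_le h.continuous_right (max u v) ε0)).exists
  refine ⟨N, fun M hM => ?_⟩
  set x := dyadic N (dyadicIndex N u) with hx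
  set y := dyadic N (dyadicIndex N v) with hy
  have hxu : x ≤ u := dyadic_dyadicIndex_le N u
  have hyv : y ≤ v := dyadic_dyadicIndex_le N v
  have hM' := h.rectControl_floorField M
  have hcomp : RectControl (P ∘ dyadic N) (Q ∘ dyadic N)
      fun m n => floorField M φp φm (dyadic N m) (dyadic N n) := by
    have := hM'.comp (monotone_dyadic N)
    simpa only [Function.comp_def, dyadic_dyadicIndex_dyadic hM] using this
  have h1 : ‖floorField M φp φm x y - floorField N φp φm u v‖ ≤ ε * K := by
    refine (h.norm_sub_schemeField_le hcomp (fun m => ?_) (fun n => ?_) ε0.le hNP hNQ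
      (fun k hk => (dyadic_le_of_lt_dyadicIndex_succ (by omega)).trans (le_max_left u v))
      (fun k hk => (dyadic_le_of_lt_dyadicIndex_succ (by omega)).trans
        (le_max_right u v))).trans ?_
    · simp [floorField, dyadic_dyadicIndex_dyadic hM]
    · simp [floorField, dyadic_dyadicIndex_dyadic hM, schemeField_zero_left h.zero_eq]
    · have := monoP hxu
      have := monoQ hyv
      exact mul_le_mul_of_nonneg_left (Real.exp_le_exp.2 (by linarith)) ε0.le
  have h2 : ‖floorField M φp φm u v - floorField M φp φm x v‖ ≤ ε := by
    refine (hM'.left hxu v).trans (le_trans ?_ (hNP x (hxu.trans (le_max_left _ _))))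
    rw [hx, dyadic_dyadicIndex_dyadic hM, ← dyadic_succ]
    have := monoP ((dyadic_dyadicIndex_le M u).trans (le_dyadic_dyadicIndex_succ N u))
    linarith
  have h3 : ‖floorField M φp φm x v - floorField M φp φm x y‖ ≤ ε := by
    refine (hM'.right x hyv).trans (le_trans ?_ (hNQ y (hyv.trans (le_max_right _ _))))
    rw [hy, dyadic_dyadicIndex_dyadic hM, ← dyadic_succ]
    have := monoQ ((dyadic_dyadicIndex_le M v).trans (le_dyadic_dyadicIndex_succ N v))
    linarith
  rw [dist_eq_norm, ← sub_add_sub_cancel _ (floorField M φp φm x y),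
    ← sub_add_sub_cancel _ (floorField M φp φm x v)]
  refine (norm_add_le _ _).trans_lt ((add_le_add ((norm_add_le _ _).trans
    (add_le_add h2 h3)) h1).trans_lt ?_)
  linarith

theorem RectControl.continuous {f : ℝ≥0 → ℝ≥0 → E d} (h : RectControl P Q f) (hP : Continuous P)
    (hQ : Continuous Q) : Continuous fun p : ℝ≥0 × ℝ≥0 => f p.1 p.2 := by
  have hl : ∀ u u' v, ‖f u' v - f u v‖ ≤ |P u' - P u| := by
    intro u u' v
    rcases le_total u u' with hu | hu
    · exact (h.left hu v).trans (le_abs_self _)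
    · rw [norm_sub_rev, abs_sub_comm]
      exact (h.left hu v).trans (le_abs_self _)
  have hr : ∀ u v v', ‖f u v' - f u v‖ ≤ |Q v' - Q v| := by
    intro u v v'
    rcases le_total v v' with hv | hv
    · exact (h.right u hv).trans (le_abs_self _)
    · rw [norm_sub_rev, abs_sub_comm]
      exact (h.right u hv).trans (le_abs_self _)
  rw [continuous_iff_continuousAt]
  rintro ⟨u, v⟩
  rw [ContinuousAt, tendsto_iff_norm_sub_tendsto_zero]
  have hlim : Tendsto (fun p : ℝ≥0 × ℝ≥0 => |P p.1 - P u| + |Q p.2 - Q v|) (𝓝 (u, v)) (𝓝 0) := by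
    have : Continuous fun p : ℝ≥0 × ℝ≥0 => |P p.1 - P u| + |Q p.2 - Q v| := by fun_prop
    simpa using this.tendsto (u, v)
  refine squeeze_zero (fun _ => norm_nonneg _) (fun p => ?_) hlim
  rw [← sub_add_sub_cancel _ (f u p.2)]
  exact (norm_add_le _ _).trans (add_le_add (hl _ _ _) (hr _ _ _))

/-- The scheme has a controlled limit. -/
theorem BoundaryControl.exists_rectControl (h : BoundaryControl P Q φp φm) :
    ∃ φ : X₂ d, RectControl P Q (fun u v => (φ (u, v) : E d)) ∧
      (∀ u, φ (u, 0) = φp u) ∧ ∀ v, φ (0, v) = φm v := by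
  choose f hf using fun u v => cauchySeq_tendsto_of_complete (h.cauchySeq_floorField u v)
  have hc : RectControl P Q f := .of_tendsto h.rectControl_floorField
    (fun u => (h.continuous_left.tendsto u).comp (tendsto_dyadic_dyadicIndex u))
    (fun u => (h.continuous_right.tendsto u).comp (tendsto_dyadic_dyadicIndex u)) hf
  have hmem : ∀ p : ℝ≥0 × ℝ≥0, f p.1 p.2 ∈ Metric.sphere (0 : E d) 1 := fun p => by
    simpa using hc.norm_eq_one p.1 p.2
  refine ⟨⟨fun p => ⟨f p.1 p.2, hmem p⟩, (hc.continuous h.continuous_left h.continuous_right).subtype_mk hmem⟩, hc,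
    fun u => ?_, fun v => ?_⟩
  · refine Subtype.ext (tendsto_nhds_unique (hf u 0) ?_)
    have := (continuous_subtype_val.comp φp.continuous).tendsto u
    simpa [floorField] using! this.comp (tendsto_dyadic_dyadicIndex u)
  · refine Subtype.ext (tendsto_nhds_unique (hf 0 v) ?_)
    have := (continuous_subtype_val.comp φm.continuous).tendsto v
    simpa [floorField, schemeField_zero_left h.zero_eq] using!
      this.comp (tendsto_dyadic_dyadicIndex v)

theorem norm_bilin_sub_le {F : Type*} [SeminormedAddCommGroup F] [NormedSpace ℝ F] {s t r : ℝ}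
    (hs : s ∈ Icc (0 : ℝ) 1) (ht : t ∈ Icc (0 : ℝ) 1) {a b c e x : F} (ha : ‖a - x‖ ≤ r)
    (hb : ‖b - x‖ ≤ r) (hc : ‖c - x‖ ≤ r) (he : ‖e - x‖ ≤ r) :
    ‖((1 - s) * (1 - t)) • a + (s * (1 - t)) • b + ((1 - s) * t) • c + (s * t) • e - x‖ ≤ r := by
  have e1 : ((1 - s) * (1 - t)) • a + (s * (1 - t)) • b + ((1 - s) * t) • c + (s * t) • e - x =
      ((1 - s) * (1 - t)) • (a - x) + (s * (1 - t)) • (b - x) + ((1 - s) * t) • (c - x)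
        + (s * t) • (e - x) := by module
  have c1 : 0 ≤ (1 - s) * (1 - t) := mul_nonneg (sub_nonneg.2 hs.2) (sub_nonneg.2 ht.2)
  have c2 : 0 ≤ s * (1 - t) := mul_nonneg hs.1 (sub_nonneg.2 ht.2)
  have c3 : 0 ≤ (1 - s) * t := mul_nonneg (sub_nonneg.2 hs.2) ht.1
  have c4 : 0 ≤ s * t := mul_nonneg hs.1 ht.1
  rw [e1]
  refine (norm_add_le _ _).trans ((add_le_add_left ((norm_add_le _ _).trans
    (add_le_add_left (norm_add_le _ _) _)) _).trans ?_)
  rw [norm_smul, norm_smul, norm_smul, norm_smul, Real.norm_of_nonneg c1, Real.norm_of_nonneg c2,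
    Real.norm_of_nonneg c3, Real.norm_of_nonneg c4]
  nlinarith [mul_le_mul_of_nonneg_left ha c1, mul_le_mul_of_nonneg_left hb c2,
    mul_le_mul_of_nonneg_left hc c3, mul_le_mul_of_nonneg_left he c4]

theorem frac_mem_Icc (u : ℝ≥0) : frac u ∈ Icc (0 : ℝ) 1 := by
  have h1 : ((⌊u⌋₊ : ℝ≥0) : ℝ) ≤ u := NNReal.coe_le_coe.2 (Nat.floor_le bot_le)
  have h2 : (u : ℝ) ≤ ((⌊u⌋₊ + 1 : ℝ≥0) : ℝ) := NNReal.coe_le_coe.2 (Nat.lt_floor_add_one _).le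
  push_cast at h1 h2
  rw [frac]
  constructor <;> linarith

/-- The scheme converges to any controlled field with the given boundary data. -/
theorem BoundaryControl.tendsto_numericalScheme (h : BoundaryControl P Q φp φm) {φ : X₂ d}
    (hφ : RectControl P Q (fun u v => (φ (u, v) : E d)))
    (hφp : ∀ u, φ (u, 0) = φp u) (hφm : ∀ v, φ (0, v) = φm v) :
    Tendsto (fun N => numericalScheme N φp φm) atTop (𝓝 (incl φ)) := by
  have monoP : Monotone P := fun x y hxy => sub_nonneg.1 ((norm_nonneg _).trans (h.left hxy))
  have monoQ : Monotone Q := fun x y hxy => sub_nonneg.1 ((norm_nonneg _).trans (h.right hxy))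
  rw [ContinuousMap.tendsto_iff_forall_isCompact_tendstoUniformlyOn]
  intro K hK
  obtain ⟨R, hR⟩ : ∃ R : ℝ≥0, ∀ p ∈ K, p.1 ≤ R ∧ p.2 ≤ R := by
    obtain ⟨r, hr⟩ := (hK.image continuous_fst).bddAbove
    obtain ⟨s, hs⟩ := (hK.image continuous_snd).bddAbove
    exact ⟨max r s, fun p hp => ⟨(hr (mem_image_of_mem _ hp)).trans (le_max_left _ _),
      (hs (mem_image_of_mem _ hp)).trans (le_max_right _ _)⟩⟩
  rw [Metric.tendstoUniformlyOn_iff]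
  intro η hη
  -- The upper corners of a cell meeting `[0, R]²` may leave that square, but by at most one mesh
  -- width, hence the `R + 1`.
  set C := Real.exp (91 * ((P (R + 1) - P 0) + (Q (R + 1) - Q 0)))
  have C0 : 0 < C := Real.exp_pos _
  obtain ⟨ε, ε0, hεη⟩ : ∃ ε : ℝ, 0 < ε ∧ ε * C + 2 * ε < η := by
    refine ⟨η / (2 * (C + 2)), by positivity, ?_⟩
    field_simp
    linarith
  filter_upwards [eventually_increment_le h.continuous_left R ε0,
    eventually_increment_le h.continuous_right R ε0] with N hNP hNQ
  rintro ⟨u, v⟩ huv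
  obtain ⟨hu, hv⟩ := hR _ huv
  simp only at hu hv
  -- All four corner values of the cell containing `(u, v)` are close to `φ (u, v)`; so is their
  -- bilinear interpolation, being a convex combination.
  have near : ∀ k l, dyadicIndex N u ≤ k → k ≤ dyadicIndex N u + 1 → dyadicIndex N v ≤ l →
      l ≤ dyadicIndex N v + 1 →
      ‖schemeField N φp φm k l - φ (u, v)‖ ≤ ε * C + 2 * ε := by
    intro k l hk hk' hl hl'
    have pow_le : (1 : ℝ≥0) / 2 ^ N ≤ 1 := by
      rw [div_le_one (by positivity)]
      exact one_le_pow₀ (by norm_num)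
    have hku : ∀ j < k, dyadic N j ≤ R := fun j hj =>
      (dyadic_le_of_lt_dyadicIndex_succ (by omega)).trans hu
    have hlv : ∀ j < l, dyadic N j ≤ R := fun j hj =>
      (dyadic_le_of_lt_dyadicIndex_succ (by omega)).trans hv
    have hkR : dyadic N k ≤ R + 1 := (monotone_dyadic N hk').trans (by
      rw [dyadic_succ]
      exact add_le_add ((dyadic_dyadicIndex_le N u).trans hu) pow_le)
    have hlR : dyadic N l ≤ R + 1 := (monotone_dyadic N hl').trans (by
      rw [dyadic_succ]
      exact add_le_add ((dyadic_dyadicIndex_le N v).trans hv) pow_le)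
    have h1 : ‖(φ (dyadic N k, dyadic N l) : E d) - schemeField N φp φm k l‖ ≤ ε * C := by
      refine (h.norm_sub_schemeField_le (f := fun u v => (φ (u, v) : E d))
        (hφ.comp (monotone_dyadic N)) (fun m => by rw [hφp]) (fun n => by rw [hφm]) ε0.le
        hNP hNQ hku hlv).trans ?_
      have := monoP hkR
      have := monoQ hlR
      exact mul_le_mul_of_nonneg_left (Real.exp_le_exp.2 (by linarith)) ε0.le
    have h2 : ‖(φ (dyadic N k, dyadic N l) : E d) - φ (u, dyadic N l)‖ ≤ ε := by
      have b := hNP _ ((dyadic_dyadicIndex_le N u).trans hu)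
      rw [← dyadic_succ] at b
      have b1 := monoP (dyadic_dyadicIndex_le N u)
      have b2 := monoP (le_dyadic_dyadicIndex_succ N u)
      have b3 := monoP (monotone_dyadic N hk)
      have b4 := monoP (monotone_dyadic N hk')
      rcases le_total u (dyadic N k) with hle | hle
      · exact (hφ.left hle _).trans (by linarith)
      · rw [norm_sub_rev]
        exact (hφ.left hle _).trans (by linarith)
    have h3 : ‖(φ (u, dyadic N l) : E d) - φ (u, v)‖ ≤ ε := by
      have b := hNQ _ ((dyadic_dyadicIndex_le N v).trans hv)
      rw [← dyadic_succ] at b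
      have b1 := monoQ (dyadic_dyadicIndex_le N v)
      have b2 := monoQ (le_dyadic_dyadicIndex_succ N v)
      have b3 := monoQ (monotone_dyadic N hl)
      have b4 := monoQ (monotone_dyadic N hl')
      rcases le_total v (dyadic N l) with hle | hle
      · exact (hφ.right _ hle).trans (by linarith)
      · rw [norm_sub_rev]
        exact (hφ.right _ hle).trans (by linarith)
    rw [norm_sub_rev] at h1
    rw [← sub_add_sub_cancel _ (φ (dyadic N k, dyadic N l) : E d),
      ← sub_add_sub_cancel (φ (dyadic N k, dyadic N l) : E d) (φ (u, dyadic N l))]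
    refine (norm_add_le _ _).trans ((add_le_add h1 ((norm_add_le _ _).trans
      (add_le_add h2 h3))).trans ?_)
    linarith
  rw [dist_comm, dist_eq_norm]
  refine lt_of_le_of_lt ?_ hεη
  exact norm_bilin_sub_le (frac_mem_Icc _) (frac_mem_Icc _)
    (near _ _ le_rfl (Nat.le_succ _) le_rfl (Nat.le_succ _))
    (near _ _ (Nat.le_succ _) le_rfl le_rfl (Nat.le_succ _))
    (near _ _ le_rfl (Nat.le_succ _) (Nat.le_succ _) le_rfl)
    (near _ _ (Nat.le_succ _) le_rfl (Nat.le_succ _) le_rfl)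

end Convergence

/-! ### Absolutely continuous functions with values in Euclidean space -/

theorem _root_.AbsolutelyContinuousOnInterval.of_dist_le {X Y : Type*} [PseudoMetricSpace X]
    [PseudoMetricSpace Y] {f : ℝ → X} {g : ℝ → Y} {a b C : ℝ}
    (hg : AbsolutelyContinuousOnInterval g a b)
    (h : ∀ x ∈ uIcc a b, ∀ y ∈ uIcc a b, dist (f x) (f y) ≤ C * dist (g x) (g y)) :
    AbsolutelyContinuousOnInterval f a b := by
  have h1 := Tendsto.const_mul C hg
  rw [mul_zero] at h1
  refine squeeze_zero' (.of_forall fun _ => Finset.sum_nonneg fun _ _ => dist_nonneg) ?_ h1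
  have : ∀ᶠ I in AbsolutelyContinuousOnInterval.totalLengthFilter ⊓
      𝓟 (AbsolutelyContinuousOnInterval.disjWithin a b),
      I ∈ AbsolutelyContinuousOnInterval.disjWithin a b :=
    eventually_inf_principal.2 (.of_forall fun _ h => h)
  filter_upwards [this] with I hI
  rw [Finset.mul_sum]
  exact Finset.sum_le_sum fun i hi => h _ (hI.1 i hi).1 _ (hI.1 i hi).2

section Euclidean

variable {n : ℕ} {f : ℝ → EuclideanSpace ℝ (Fin n)} {a b : ℝ}

/-- Passing to coordinates reduces the vector-valued fundamental theorem of calculus below to the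
real one. -/
theorem _root_.AbsolutelyContinuousOnInterval.euclidean_apply
    (hf : AbsolutelyContinuousOnInterval f a b) (i : Fin n) :
    AbsolutelyContinuousOnInterval (fun x => f x i) a b :=
  hf.of_dist_le (C := 1) fun x _ y _ => by
    rw [one_mul, Real.dist_eq, dist_eq_norm, ← PiLp.sub_apply]
    exact PiLp.norm_apply_le (f x - f y) i

theorem _root_.AbsolutelyContinuousOnInterval.ae_differentiableAt_euclidean
    (hf : AbsolutelyContinuousOnInterval f a b) :
    ∀ᵐ x, x ∈ uIcc a b → DifferentiableAt ℝ f x := by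
  have := ae_all_iff.2 fun i => (hf.euclidean_apply i).ae_differentiableAt
  filter_upwards [this] with x hx hx'
  exact differentiableAt_euclidean.2 fun i => hx i hx'

theorem deriv_euclidean_apply {x : ℝ} (hf : DifferentiableAt ℝ f x) (i : Fin n) :
    deriv f x i = deriv (fun y => f y i) x :=
  (((EuclideanSpace.proj i : EuclideanSpace ℝ (Fin n) →L[ℝ] ℝ).hasFDerivAt.comp_hasDerivAt x
    hf.hasDerivAt).deriv).symm

theorem intervalIntegrable_euclidean {μ : Measure ℝ}
    (hf : ∀ i, IntervalIntegrable (fun x => f x i) μ a b) :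
    IntervalIntegrable f μ a b := by
  rw [intervalIntegrable_iff]
  have : Integrable (fun x => WithLp.ofLp (f x)) (μ.restrict (uIoc a b)) :=
    Integrable.of_eval fun i => (intervalIntegrable_iff.1 (hf i))
  exact (PiLp.continuousLinearEquiv 2 ℝ
    (fun _ : Fin n => ℝ)).symm.toContinuousLinearMap.integrable_comp this

theorem _root_.AbsolutelyContinuousOnInterval.intervalIntegrable_deriv_euclidean
    (hf : AbsolutelyContinuousOnInterval f a b) :
    IntervalIntegrable (deriv f) volume a b := by
  refine intervalIntegrable_euclidean fun i => ?_
  refine (hf.euclidean_apply i).intervalIntegrable_deriv.congr_ae ?_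
  rw [EventuallyEq, ae_restrict_iff' measurableSet_uIoc]
  filter_upwards [hf.ae_differentiableAt_euclidean] with x hx hx'
  exact (deriv_euclidean_apply (hx (uIoc_subset_uIcc hx')) i).symm

theorem intervalIntegral_euclidean_apply (hf : IntervalIntegrable f volume a b) (i : Fin n) :
    (∫ x in a..b, f x) i = ∫ x in a..b, f x i :=
  ((EuclideanSpace.proj i : EuclideanSpace ℝ (Fin n) →L[ℝ] ℝ).intervalIntegral_comp_comm hf).symm

theorem _root_.AbsolutelyContinuousOnInterval.integral_deriv_euclidean
    (hf : AbsolutelyContinuousOnInterval f a b) :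
    ∫ x in a..b, deriv f x = f b - f a := by
  ext i
  rw [intervalIntegral_euclidean_apply hf.intervalIntegrable_deriv_euclidean, PiLp.sub_apply,
    ← (hf.euclidean_apply i).integral_deriv_eq_sub]
  refine intervalIntegral.integral_congr_ae ?_
  filter_upwards [hf.ae_differentiableAt_euclidean] with x hx hx'
  exact deriv_euclidean_apply (hx (uIoc_subset_uIcc hx')) i

end Euclidean

theorem _root_.IntervalIntegrable.absolutelyContinuousOnInterval_primitive {F : Type*}
    [NormedAddCommGroup F] [NormedSpace ℝ F] {g : ℝ → F} {a b : ℝ}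
    (hg : IntervalIntegrable g volume a b) :
    AbsolutelyContinuousOnInterval (fun x => ∫ w in a..x, g w) a b := by
  refine (hg.norm.absolutelyContinuousOnInterval_intervalIntegral left_mem_uIcc).of_dist_le
    (C := 1) fun x hx y hy => ?_
  have sub : ∀ {x}, x ∈ uIcc a b → uIcc a x ⊆ uIcc a b := fun hx =>
    uIcc_subset_uIcc left_mem_uIcc hx
  rw [one_mul, dist_eq_norm, Real.dist_eq,
    intervalIntegral.integral_interval_sub_left (hg.mono_set (sub hx)) (hg.mono_set (sub hy)),
    intervalIntegral.integral_interval_sub_left (hg.norm.mono_set (sub hx))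
      (hg.norm.mono_set (sub hy))]
  exact intervalIntegral.norm_integral_le_abs_integral_norm

/-! ### Arc length of the boundary data -/

section Length

variable {d : ℕ} {φ : X₁ d}

theorem lift₁_coe (φ : X₁ d) (u : ℝ≥0) : lift₁ φ u = φ u := by simp [lift₁]

theorem LocallyAC.intervalIntegrable_deriv (h : LocallyAC φ) (a b : ℝ) :
    IntervalIntegrable (deriv (lift₁ φ)) volume a b := by
  have : ∀ c, IntervalIntegrable (deriv (lift₁ φ)) volume 0 c := by
    intro c
    rcases lt_trichotomy c 0 with hc | rfl | hc
    -- `lift₁` is constant on the negative axis, so the derivative vanishes there.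
    · have h0 : IntervalIntegrable (fun _ => (0 : E d)) volume 0 c := intervalIntegrable_const
      refine h0.congr_uIoo fun x hx => ?_
      rw [uIoo_of_ge hc.le] at hx
      refine (HasDerivAt.deriv ?_).symm
      refine (hasDerivAt_const x (φ 0 : E d)).congr_of_eventuallyEq ?_
      filter_upwards [gt_mem_nhds hx.2] with y hy
      simp [lift₁, Real.toNNReal_of_nonpos hy.le]
    · simp
    · exact (h c hc).intervalIntegrable_deriv_euclidean
  exact (this a).symm.trans (this b)

theorem LocallyAC.absolutelyContinuousOnInterval (h : LocallyAC φ) {a b : ℝ} (ha : 0 ≤ a)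
    (hb : 0 ≤ b) : AbsolutelyContinuousOnInterval (lift₁ φ) a b := by
  have : 0 < max a b + 1 := by positivity
  refine (h _ this).mono ?_
  rw [uIcc_of_le this.le]
  refine uIcc_subset_Icc ⟨ha, ?_⟩ ⟨hb, ?_⟩
  · linarith [le_max_left a b]
  · linarith [le_max_right a b]

theorem LocallyAC.integral_deriv (h : LocallyAC φ) {a b : ℝ} (ha : 0 ≤ a) (hb : 0 ≤ b) :
    ∫ w in a..b, deriv (lift₁ φ) w = lift₁ φ b - lift₁ φ a :=
  (h.absolutelyContinuousOnInterval ha hb).integral_deriv_euclidean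

/-- The length of the path `φ` on `[0, u]`. -/
def pathLength (φ : X₁ d) (u : ℝ≥0) : ℝ := ∫ w in (0 : ℝ)..u, ‖deriv (lift₁ φ) w‖

theorem LocallyAC.pathLength_sub (h : LocallyAC φ) (u u' : ℝ≥0) :
    pathLength φ u' - pathLength φ u = ∫ w in (u : ℝ)..u', ‖deriv (lift₁ φ) w‖ :=
  intervalIntegral.integral_interval_sub_left (h.intervalIntegrable_deriv _ _).norm
    (h.intervalIntegrable_deriv _ _).norm

theorem LocallyAC.norm_sub_le (h : LocallyAC φ) {u u' : ℝ≥0} (hu : u ≤ u') :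
    ‖(φ u' : E d) - φ u‖ ≤ pathLength φ u' - pathLength φ u := by
  rw [h.pathLength_sub, ← lift₁_coe, ← lift₁_coe, ← h.integral_deriv u.coe_nonneg u'.coe_nonneg]
  exact intervalIntegral.norm_integral_le_integral_norm hu

theorem LocallyAC.continuous_pathLength (h : LocallyAC φ) : Continuous (pathLength φ) :=
  (intervalIntegral.continuous_primitive
    (fun a b => (h.intervalIntegrable_deriv a b).norm) 0).comp NNReal.continuous_coe

theorem LocallyAC.monotone_pathLength (h : LocallyAC φ) : Monotone (pathLength φ) :=
  fun _ _ hu => sub_nonneg.1 ((norm_nonneg _).trans (h.norm_sub_le hu))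

theorem LocallyAC.absolutelyContinuousOnInterval_pathLength (h : LocallyAC φ) {a : ℝ}
    (ha : 0 ≤ a) : AbsolutelyContinuousOnInterval (fun x => pathLength φ x.toNNReal) 0 a := by
  refine (h.intervalIntegrable_deriv 0 a).norm.absolutelyContinuousOnInterval_primitive.of_dist_le
    (C := 1) fun x hx y hy => ?_
  rw [uIcc_of_le ha] at hx hy
  rw [one_mul, pathLength, pathLength, Real.coe_toNNReal x hx.1, Real.coe_toNNReal y hy.1]

theorem LocallyAC.boundaryControl {φp φm : X₁ d} (hp : LocallyAC φp) (hm : LocallyAC φm)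
    (h0 : φm 0 = φp 0) : BoundaryControl (pathLength φp) (pathLength φm) φp φm :=
  ⟨h0, fun _ _ => hp.norm_sub_le, fun _ _ => hm.norm_sub_le, hp.continuous_pathLength,
    hm.continuous_pathLength⟩

end Length

/-! ### Controlled fields are wave maps -/

/-- Comparison of right difference quotients. -/
theorem norm_le_of_hasDerivAt_of_norm_sub_le {F : Type*} [NormedAddCommGroup F] [NormedSpace ℝ F]
    {g : ℝ → F} {h : ℝ → ℝ} {g' : F} {h' u : ℝ} (hg : HasDerivAt g g' u) (hh : HasDerivAt h h' u)
    (H : ∀ w > u, ‖g w - g u‖ ≤ h w - h u) : ‖g'‖ ≤ h' := by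
  have h1 := ((hasDerivWithinAt_iff_tendsto_slope' self_notMem_Ioi).1
    (hg.hasDerivWithinAt (s := Ioi u))).norm
  have h2 := (hasDerivWithinAt_iff_tendsto_slope' self_notMem_Ioi).1
    (hh.hasDerivWithinAt (s := Ioi u))
  refine le_of_tendsto_of_tendsto h1 h2 ?_
  filter_upwards [self_mem_nhdsWithin] with w hw
  have : 0 < w - u := sub_pos.2 hw
  rw [slope_def_module, slope_def_field, norm_smul, norm_inv, Real.norm_of_nonneg this.le,
    inv_mul_eq_div]
  gcongr
  exact H w hw

namespace RectControl

variable {d : ℕ}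

theorem norm_left_le_abs {ι : Type*} [LinearOrder ι] {P Q : ι → ℝ} {f : ι → ι → E d}
    (h : RectControl P Q f) (u u' v : ι) : ‖f u' v - f u v‖ ≤ |P u' - P u| := by
  rcases le_total u u' with hu | hu
  · exact (h.left hu v).trans (le_abs_self _)
  · rw [norm_sub_rev, abs_sub_comm]
    exact (h.left hu v).trans (le_abs_self _)

theorem norm_right_le_abs {ι : Type*} [LinearOrder ι] {P Q : ι → ℝ} {f : ι → ι → E d}
    (h : RectControl P Q f) (u v v' : ι) : ‖f u v' - f u v‖ ≤ |Q v' - Q v| := by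
  rcases le_total v v' with hv | hv
  · exact (h.right u hv).trans (le_abs_self _)
  · rw [norm_sub_rev, abs_sub_comm]
    exact (h.right u hv).trans (le_abs_self _)

variable {p q : ℝ → ℝ} {f : ℝ → ℝ → E d}

theorem norm_box_le_abs (h : RectControl p q f) (u u' v v' : ℝ) :
    ‖f u' v' - f u' v - f u v' + f u v‖ ≤ 17 * |p u' - p u| * |q v' - q v| := by
  wlog hu : u ≤ u' generalizing u u'
  · have := this u' u (le_of_not_ge hu)
    rw [abs_sub_comm, ← norm_neg] at this
    refine le_of_eq_of_le ?_ this
    congr 1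
    abel
  wlog hv : v ≤ v' generalizing v v'
  · have := this v' v (le_of_not_ge hv)
    rw [abs_sub_comm (q v), ← norm_neg] at this
    refine le_of_eq_of_le ?_ this
    congr 1
    abel
  rw [abs_of_nonneg (sub_nonneg.2 (h.monotone_left hu)),
    abs_of_nonneg (sub_nonneg.2 (h.monotone_right hv))]
  exact h.box hu hv

theorem absolutelyContinuousOnInterval_left (h : RectControl p q f) {a b : ℝ}
    (hp : AbsolutelyContinuousOnInterval p a b) (v : ℝ) :
    AbsolutelyContinuousOnInterval (fun w => f w v) a b :=
  hp.of_dist_le (C := 1) fun x _ y _ => by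
    rw [one_mul, dist_eq_norm, Real.dist_eq]
    exact h.norm_left_le_abs y x v

theorem absolutelyContinuousOnInterval_right (h : RectControl p q f) {a b : ℝ}
    (hq : AbsolutelyContinuousOnInterval q a b) (u : ℝ) :
    AbsolutelyContinuousOnInterval (fun z => f u z) a b :=
  hq.of_dist_le (C := 1) fun x _ y _ => by
    rw [one_mul, dist_eq_norm, Real.dist_eq]
    exact h.norm_right_le_abs u y x

/-- Difference quotients of the slices at `v` and at a rational `r` differ by at most `17 |slope p|
|q v - q r|`, so those at `v` are Cauchy. The exceptional null set of `u` can thus be chosen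
independently of `v`. -/
theorem differentiableAt_left (h : RectControl p q f) (hq : Continuous q) {u : ℝ}
    (hp : DifferentiableAt ℝ p u) (hr : ∀ r : ℚ, DifferentiableAt ℝ (fun w => f w r) u) (v : ℝ) :
    DifferentiableAt ℝ (fun w => f w v) u := by
  suffices Cauchy (map (slope (fun w => f w v) u) (𝓝[≠] u)) by
    obtain ⟨L, hL⟩ := cauchy_map_iff_exists_tendsto.1 this
    exact (hasDerivAt_iff_tendsto_slope.2 hL).differentiableAt
  rw [Metric.cauchy_iff]
  refine ⟨inferInstance, fun ε hε => ?_⟩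
  set c := |deriv p u| + 1 with hc
  have c0 : 0 < c := by positivity
  have hpc : ∀ᶠ w in 𝓝[≠] u, |slope p u w| < c :=
    hp.hasDerivAt.tendsto_slope.abs.eventually (gt_mem_nhds (lt_add_one _))
  obtain ⟨r, hvr⟩ : ∃ r : ℚ, 17 * c * |q v - q r| < ε / 4 := by
    have ho : IsOpen {x : ℝ | 17 * c * |q v - q x| < ε / 4} :=
      isOpen_lt (by fun_prop) continuous_const
    obtain ⟨x, hx⟩ := Rat.denseRange_cast.exists_mem_open ho ⟨v, by simpa using hε⟩
    exact ⟨x, hx⟩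
  have hrL := (hr r).hasDerivAt.tendsto_slope.eventually
    (Metric.ball_mem_nhds _ (show 0 < ε / 4 by positivity))
  set L := deriv (fun w => f w r) u
  have key : ∀ᶠ w in 𝓝[≠] u, dist (slope (fun w => f w v) u w) L < ε / 2 := by
    filter_upwards [hpc, hrL] with w h1 h2
    have h3 : dist (slope (fun w => f w v) u w) (slope (fun w => f w r) u w) < ε / 4 := by
      refine lt_of_le_of_lt ?_ hvr
      rw [dist_eq_norm, slope_def_module, slope_def_module, ← smul_sub, norm_smul, norm_inv,
        Real.norm_eq_abs]
      have e : f w v - f u v - (f w r - f u r) = f w v - f w r - f u v + f u r := by abel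
      rw [e]
      calc |w - u|⁻¹ * ‖f w v - f w r - f u v + f u r‖
          ≤ |w - u|⁻¹ * (17 * |p w - p u| * |q v - q r|) := by
            gcongr
            exact h.norm_box_le_abs _ _ _ _
        _ = 17 * |slope p u w| * |q v - q r| := by
            rw [slope_def_field, abs_div]
            ring
        _ ≤ _ := by gcongr
    linarith [dist_triangle (slope (fun w => f w v) u w) (slope (fun w => f w r) u w) L]
  refine ⟨_, image_mem_map key, ?_⟩
  rintro _ ⟨w, hw, rfl⟩ _ ⟨w', hw', rfl⟩
  have := dist_triangle_right (slope (fun w => f w v) u w) (slope (fun w => f w v) u w') L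
  simp only [mem_ofPred_eq] at hw hw'
  linarith

section Derivative

variable {u : ℝ}

theorem norm_deriv_left_le (h : RectControl p q f) (hp : DifferentiableAt ℝ p u) {v : ℝ}
    (hf : DifferentiableAt ℝ (fun w => f w v) u) : ‖deriv (fun w => f w v) u‖ ≤ deriv p u :=
  norm_le_of_hasDerivAt_of_norm_sub_le hf.hasDerivAt hp.hasDerivAt fun _ hw => h.left hw.le v

theorem norm_deriv_right_le (h : RectControl p q f) {v : ℝ} (hq : DifferentiableAt ℝ q v)
    (hf : DifferentiableAt ℝ (fun z => f u z) v) : ‖deriv (fun z => f u z) v‖ ≤ deriv q v :=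
  norm_le_of_hasDerivAt_of_norm_sub_le hf.hasDerivAt hq.hasDerivAt fun _ hw => h.right u hw.le

theorem norm_deriv_left_sub_le (h : RectControl p q f) (hp : DifferentiableAt ℝ p u)
    (hf : ∀ v, DifferentiableAt ℝ (fun w => f w v) u) (v v' : ℝ) :
    ‖deriv (fun w => f w v') u - deriv (fun w => f w v) u‖ ≤ 17 * deriv p u * |q v' - q v| := by
  have h1 := (hf v').hasDerivAt.sub (hf v).hasDerivAt
  have h2 := (hp.hasDerivAt.const_mul 17).mul_const (|q v' - q v|)
  refine norm_le_of_hasDerivAt_of_norm_sub_le h1 h2 fun w hw => ?_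
  have h3 := h.norm_box_le_abs u w v v'
  rw [abs_of_nonneg (sub_nonneg.2 (h.monotone_left (le_of_lt hw)))] at h3
  refine le_of_eq_of_le ?_ (h3.trans_eq (by ring))
  simp only [Pi.sub_apply]
  congr 1
  abel

/-- This is `box_add` divided by the width in `u` in the limit of zero width; the summand with two
factors of `p` disappears and leaves the square of the increment of `q`. -/
theorem norm_deriv_left_sub_add_le (h : RectControl p q f) (hp : DifferentiableAt ℝ p u)
    (hf : ∀ v, DifferentiableAt ℝ (fun w => f w v) u) {v v' : ℝ} (hv : v ≤ v') :
    ‖deriv (fun w => f w v') u - deriv (fun w => f w v) u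
      + inner ℝ (deriv (fun w => f w v) u) (f u v' - f u v) • f u v‖ ≤
      22 * deriv p u * (q v' - q v) ^ 2 := by
  have h1 := ((hf v').hasDerivAt.sub (hf v).hasDerivAt).add
    (((hf v).hasDerivAt.inner ℝ (hasDerivAt_const u (f u v' - f u v))).smul_const (f u v))
  have hp' := hp.hasDerivAt.sub_const (p u)
  have h2 := ((hp'.const_mul 22).mul_const (q v' - q v)).mul (hp'.add_const (q v' - q v))
  rw [inner_zero_right, zero_add] at h1
  refine (norm_le_of_hasDerivAt_of_norm_sub_le h1 h2 fun w hw => ?_).trans_eq (by simp; ring)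
  refine le_of_eq_of_le ?_ ((h.box_add (le_of_lt hw) hv).trans_eq (by simp))
  simp only [Pi.sub_apply, Pi.add_apply, inner_sub_left]
  congr 1
  module

/-- Dividing once more, now in `v`: the error is quadratic in the increment of `q`, so its
derivative at `v` is zero and the equation holds pointwise. -/
theorem hasDerivAt_deriv_left (h : RectControl p q f) (hp : DifferentiableAt ℝ p u)
    (hf : ∀ v, DifferentiableAt ℝ (fun w => f w v) u) {v : ℝ} (hq : DifferentiableAt ℝ q v)
    (hfv : DifferentiableAt ℝ (fun z => f u z) v)
    (ha : DifferentiableAt ℝ (fun z => deriv (fun w => f w z) u) v) :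
    deriv (fun z => deriv (fun w => f w z) u) v = -(nullForm f u v • f u v) := by
  have h1 := ha.hasDerivAt.add
    (((hasDerivAt_const v (deriv (fun w => f w v) u)).inner ℝ hfv.hasDerivAt).smul_const (f u v))
  have h2 := ((hq.hasDerivAt.sub_const (q v)).pow 2).const_mul (22 * deriv p u)
  have := norm_le_of_hasDerivAt_of_norm_sub_le h1 h2 fun w hw => by
    refine le_of_eq_of_le ?_ ((h.norm_deriv_left_sub_add_le hp hf (le_of_lt hw)).trans_eq
      (by simp))
    simp only [Pi.add_apply, inner_sub_right]
    congr 1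
    module
  simp only [sub_self, inner_zero_left, add_zero] at this
  norm_num at this
  exact eq_neg_of_add_eq_zero_left this

end Derivative

section WaveMap

variable {u₀ v₀ : ℝ}

/-- As a function of `z`, `∂_u f(u, z)` has increments dominated by those of `q`, hence it is
absolutely continuous and the integral of its derivative. -/
theorem deriv_left_sub_eq_integral (h : RectControl p q f) {u : ℝ} (hp : DifferentiableAt ℝ p u)
    (hf : ∀ v, DifferentiableAt ℝ (fun w => f w v) u) {v : ℝ}
    (hq : AbsolutelyContinuousOnInterval q 0 v) :
    deriv (fun w => f w v) u - deriv (fun w => f w 0) u =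
      -∫ z in (0 : ℝ)..v, nullForm f u z • f u z := by
  have hac : AbsolutelyContinuousOnInterval (fun z => deriv (fun w => f w z) u) 0 v :=
    hq.of_dist_le (C := 17 * deriv p u) fun x _ y _ => by
      rw [dist_eq_norm, Real.dist_eq]
      exact h.norm_deriv_left_sub_le hp hf y x
  rw [← hac.integral_deriv_euclidean, ← intervalIntegral.integral_neg]
  refine intervalIntegral.integral_congr_ae ?_
  filter_upwards [hac.ae_differentiableAt_euclidean, hq.ae_differentiableAt,
    (h.absolutelyContinuousOnInterval_right hq u).ae_differentiableAt_euclidean] with z h1 h2 h3 hz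
  have hz' := uIoc_subset_uIcc hz
  exact h.hasDerivAt_deriv_left hp hf (h2 hz') (h3 hz') (h1 hz')

theorem ae_differentiableAt_left (h : RectControl p q f) (hq : Continuous q) {a b : ℝ}
    (hp : AbsolutelyContinuousOnInterval p a b) :
    ∀ᵐ u, u ∈ uIcc a b → DifferentiableAt ℝ p u ∧ ∀ v, DifferentiableAt ℝ (fun w => f w v) u := by
  have h1 : ∀ᵐ u, ∀ r : ℚ, u ∈ uIcc a b → DifferentiableAt ℝ (fun w => f w r) u :=
    ae_all_iff.2 fun r => (h.absolutelyContinuousOnInterval_left hp r).ae_differentiableAt_euclidean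
  filter_upwards [h1, hp.ae_differentiableAt] with u h2 h3 hu
  exact ⟨h3 hu, h.differentiableAt_left hq (h3 hu) fun r => h2 r hu⟩

theorem eq_sub_integral (h : RectControl p q f) (hqc : Continuous q) {u v : ℝ}
    (hp : AbsolutelyContinuousOnInterval p 0 u) (hq : AbsolutelyContinuousOnInterval q 0 v) :
    f u v = f u 0 + f 0 v - f 0 0 -
      ∫ w in (0 : ℝ)..u, ∫ z in (0 : ℝ)..v, nullForm f w z • f w z := by
  have hac := (h.absolutelyContinuousOnInterval_left hp v).fun_sub
    (h.absolutelyContinuousOnInterval_left hp 0)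
  have h1 := hac.integral_deriv_euclidean
  have h2 : ∫ w in (0 : ℝ)..u, deriv (fun w => f w v - f w 0) w =
      -∫ w in (0 : ℝ)..u, ∫ z in (0 : ℝ)..v, nullForm f w z • f w z := by
    rw [← intervalIntegral.integral_neg]
    refine intervalIntegral.integral_congr_ae ?_
    filter_upwards [h.ae_differentiableAt_left hqc hp] with w hw hwu
    obtain ⟨h3, h4⟩ := hw (uIoc_subset_uIcc hwu)
    rw [← h.deriv_left_sub_eq_integral h3 h4 hq, deriv_fun_sub (h4 v) (h4 0)]
  have h3 : (∫ w in (0 : ℝ)..u, ∫ z in (0 : ℝ)..v, nullForm f w z • f w z) =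
      -(f u v - f u 0 - (f 0 v - f 0 0)) := by
    rw [← h1, h2, neg_neg]
  rw [h3]
  abel

theorem isWaveMapOn (h : RectControl p q f) (hf : Continuous f.uncurry) (hqc : Continuous q)
    (hu : 0 ≤ u₀) (hv : 0 ≤ v₀) (hp : AbsolutelyContinuousOnInterval p 0 u₀)
    (hq : AbsolutelyContinuousOnInterval q 0 v₀) :
    IsWaveMapOn u₀ v₀ (fun u => f u 0) (fun v => f 0 v) f := by
  have hf' : Continuous (fun v u => f u v).uncurry := hf.comp continuous_swap
  have m1 : MeasurableSet {x : ℝ × ℝ | DifferentiableAt ℝ (fun w => f w x.2) x.1} :=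
    (measurableSet_of_differentiableAt_with_param ℝ hf').preimage measurable_swap
  have m2 : MeasurableSet {x : ℝ × ℝ | DifferentiableAt ℝ (fun z => f x.1 z) x.2} :=
    measurableSet_of_differentiableAt_with_param ℝ hf
  have hprod : (volume : Measure (ℝ × ℝ)).restrict (Icc 0 u₀ ×ˢ Icc 0 v₀) =
      (volume.restrict (Icc 0 u₀)).prod (volume.restrict (Icc 0 v₀)) := by
    rw [Measure.volume_eq_prod, Measure.prod_restrict]
  have d1 := h.ae_differentiableAt_left hqc hp
  have hdiff : ∀ᵐ x ∂((volume : Measure (ℝ × ℝ)).restrict (Icc 0 u₀ ×ˢ Icc 0 v₀)),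
      DifferentiableAt ℝ (fun w => f w x.2) x.1 ∧ DifferentiableAt ℝ (fun z => f x.1 z) x.2 := by
    rw [hprod, Measure.ae_prod_iff_ae_ae (p := fun x : ℝ × ℝ =>
      DifferentiableAt ℝ (fun w => f w x.2) x.1 ∧ DifferentiableAt ℝ (fun z => f x.1 z) x.2)
      (m1.inter m2), ae_restrict_iff' measurableSet_Icc]
    filter_upwards [d1] with u h1 hu'
    rw [ae_restrict_iff' measurableSet_Icc]
    filter_upwards [(h.absolutelyContinuousOnInterval_right hq u).ae_differentiableAt_euclidean]
      with v h2 hv'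
    rw [uIcc_of_le hu] at h1
    rw [uIcc_of_le hv] at h2
    exact ⟨(h1 hu').2 v, h2 hv'⟩
  refine ⟨fun u _ v _ => h.norm_eq_one u v, hdiff, ?_, fun u hu' v hv' => ?_⟩
  · have i1 : Integrable (deriv p) (volume.restrict (Icc 0 u₀)) := by
      have := (intervalIntegrable_iff_integrableOn_Icc_of_le hu).1 hp.intervalIntegrable_deriv
      exact this
    have i2 : Integrable (deriv q) (volume.restrict (Icc 0 v₀)) := by
      have := (intervalIntegrable_iff_integrableOn_Icc_of_le hv).1 hq.intervalIntegrable_deriv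
      exact this
    -- The null form is dominated by `p'(u) q'(v)`, a product of integrable functions.
    have i3 := i1.mul_prod i2
    rw [← hprod] at i3
    have hmeas : Measurable fun x : ℝ × ℝ => nullForm f x.1 x.2 :=
      Measurable.inner ((measurable_deriv_with_param hf').comp measurable_swap)
        (measurable_deriv_with_param hf)
    refine Integrable.mono' i3 hmeas.aestronglyMeasurable ?_
    have e1 : ∀ᵐ x ∂((volume.restrict (Icc 0 u₀)).prod (volume.restrict (Icc 0 v₀))),
        DifferentiableAt ℝ p x.1 := by
      refine Measure.quasiMeasurePreserving_fst.ae (p := fun x => DifferentiableAt ℝ p x) ?_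
      rw [ae_restrict_iff' measurableSet_Icc, ← uIcc_of_le hu]
      exact hp.ae_differentiableAt
    have e2 : ∀ᵐ x ∂((volume.restrict (Icc 0 u₀)).prod (volume.restrict (Icc 0 v₀))),
        DifferentiableAt ℝ q x.2 := by
      refine Measure.quasiMeasurePreserving_snd.ae (p := fun x => DifferentiableAt ℝ q x) ?_
      rw [ae_restrict_iff' measurableSet_Icc, ← uIcc_of_le hv]
      exact hq.ae_differentiableAt
    rw [← hprod] at e1 e2
    filter_upwards [hdiff, e1, e2] with x h1 h2 h3
    refine (norm_inner_le_norm (𝕜 := ℝ) _ _).trans ?_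
    have b1 := h.norm_deriv_left_le h2 h1.1
    have b2 := h.norm_deriv_right_le h3 h1.2
    exact mul_le_mul b1 b2 (norm_nonneg _) ((norm_nonneg _).trans b1)
  · refine h.eq_sub_integral hqc (hp.mono ?_) (hq.mono ?_)
    · rw [uIcc_of_le hu, uIcc_of_le hu'.1]
      exact Icc_subset_Icc_right hu'.2
    · rw [uIcc_of_le hv, uIcc_of_le hv'.1]
      exact Icc_subset_Icc_right hv'.2

end WaveMap

end RectControl

theorem continuous_lift₂ {d : ℕ} (φ : X₂ d) : Continuous (lift₂ φ).uncurry := by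
  unfold lift₂ Function.uncurry
  fun_prop

/-- A field controlled by the lengths of its boundary data is a wave map. -/
theorem RectControl.isWaveMap {d : ℕ} {φp φm : X₁ d} {φ : X₂ d} (hp : LocallyAC φp)
    (hm : LocallyAC φm)
    (h : RectControl (pathLength φp) (pathLength φm) (fun u v => (φ (u, v) : E d)))
    (hφp : ∀ u, φ (u, 0) = φp u) (hφm : ∀ v, φ (0, v) = φm v) : IsWaveMap φp φm φ := by
  intro u₀ v₀ hu hv
  have h' : RectControl (fun x => pathLength φp x.toNNReal) (fun x => pathLength φm x.toNNReal)
    (lift₂ φ) := h.comp fun _ _ => Real.toNNReal_mono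
  have := h'.isWaveMapOn (continuous_lift₂ φ)
    (hm.continuous_pathLength.comp continuous_real_toNNReal) hu.le hv.le
    (hp.absolutelyContinuousOnInterval_pathLength hu.le)
    (hm.absolutelyContinuousOnInterval_pathLength hv.le)
  simpa only [lift₂, lift₁, Real.toNNReal_zero, hφp, hφm, funext_iff] using! this

/-! ### Wave maps are controlled fields -/

/-- Integral representation of a field of unit vectors `f` on `[0, u₀] × [0, v₀]` with
mixed derivative `-G` parallel to `f` and boundary values determined by `F` and `H`. -/
structure HasParallelBox {d : ℕ} (u₀ v₀ : ℝ) (F H : ℝ → E d) (G : ℝ × ℝ → E d)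
    (f : ℝ → ℝ → E d) : Prop where
  norm_eq_one : ∀ u ∈ Icc 0 u₀, ∀ v ∈ Icc 0 v₀, ‖f u v‖ = 1
  continuous : Continuous f.uncurry
  stronglyMeasurable : StronglyMeasurable G
  integrable : Integrable G
  parallel : ∀ x, ∃ c : ℝ, G x = c • f x.1 x.2
  intervalIntegrable_deriv : ∀ a b, IntervalIntegrable (deriv F) volume a b
  integral_deriv : ∀ u ∈ Icc 0 u₀, ∫ w in (0 : ℝ)..u, deriv F w = F u - F 0
  eq_integral : ∀ u ∈ Icc 0 u₀, ∀ v ∈ Icc 0 v₀,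
    f u v = F u + H v - ∫ w in (0 : ℝ)..u, ∫ z in (0 : ℝ)..v, G (w, z)

/-- The derivative `∂_u f` as obtained from the integral representation. -/
def leftDeriv {d : ℕ} (F : ℝ → E d) (G : ℝ × ℝ → E d) (w v : ℝ) : E d :=
  deriv F w - ∫ z in (0 : ℝ)..v, G (w, z)

namespace HasParallelBox

variable {d : ℕ} {u₀ v₀ : ℝ} {F H : ℝ → E d} {G : ℝ × ℝ → E d} {f : ℝ → ℝ → E d}

theorem intervalIntegrable_integral (h : HasParallelBox u₀ v₀ F H G f) (a b c e : ℝ) :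
    IntervalIntegrable (fun w => ∫ z in c..e, G (w, z)) volume a b := by
  have h1 : ∀ s : Set ℝ, Integrable (fun w => ∫ z in s, G (w, z)) volume := fun s => by
    refine Integrable.integral_prod_left (f := G) (h.integrable.mono_measure ?_)
    rw [Measure.volume_eq_prod]
    exact Measure.prod_mono le_rfl Measure.restrict_le_self
  exact ((h1 _).sub (h1 _)).intervalIntegrable

theorem intervalIntegrable_leftDeriv (h : HasParallelBox u₀ v₀ F H G f) (a b v : ℝ) :
    IntervalIntegrable (fun w => leftDeriv F G w v) volume a b :=
  (h.intervalIntegrable_deriv a b).sub (h.intervalIntegrable_integral a b 0 v)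

theorem integral_leftDeriv (h : HasParallelBox u₀ v₀ F H G f) {u u' v : ℝ} (hu : u ∈ Icc 0 u₀)
    (hu' : u' ∈ Icc 0 u₀) (hv : v ∈ Icc 0 v₀) :
    ∫ w in u..u', leftDeriv F G w v = f u' v - f u v := by
  have h0 : ∀ u ∈ Icc 0 u₀, ∫ w in (0 : ℝ)..u, leftDeriv F G w v = f u v - f 0 v := by
    intro u hu
    have h00 : (0 : ℝ) ∈ Icc 0 u₀ := ⟨le_rfl, hu.1.trans hu.2⟩
    unfold leftDeriv
    rw [intervalIntegral.integral_sub (h.intervalIntegrable_deriv _ _)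
      (h.intervalIntegrable_integral _ _ _ _), h.integral_deriv u hu, h.eq_integral u hu v hv,
      h.eq_integral 0 h00 v hv, intervalIntegral.integral_same]
    abel
  rw [← intervalIntegral.integral_interval_sub_left (a := 0)
    (h.intervalIntegrable_leftDeriv _ _ _) (h.intervalIntegrable_leftDeriv _ _ _), h0 u hu, h0 u' hu']
  abel

theorem ae_hasDerivAt_left (h : HasParallelBox u₀ v₀ F H G f) {v : ℝ} (hv : v ∈ Icc 0 v₀) :
    ∀ᵐ w, w ∈ Icc 0 u₀ → HasDerivAt (fun w => f w v) (leftDeriv F G w v) w := by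
  have h1 := (h.intervalIntegrable_leftDeriv 0 u₀ v).ae_hasDerivAt_integral
  -- The representation holds only inside the rectangle, so a two-sided derivative requires the
  -- endpoints to be removed.
  filter_upwards [h1, Measure.ae_ne volume 0, Measure.ae_ne volume u₀] with w h2 h3 h4 hw
  have hu₀ : 0 ≤ u₀ := hw.1.trans hw.2
  rw [uIcc_of_le hu₀] at h2
  have h5 := (h2 hw 0 ⟨le_rfl, hu₀⟩).const_add (f 0 v)
  refine h5.congr_of_eventuallyEq ?_
  filter_upwards [Ioo_mem_nhds (lt_of_le_of_ne hw.1 h3.symm) (lt_of_le_of_ne hw.2 h4)] with x hx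
  rw [h.integral_leftDeriv ⟨le_rfl, hu₀⟩ (Ioo_subset_Icc_self hx) hv]
  abel

/-- The integral with moving endpoint becomes an integral over all of `ℝ` of an indicator depending
measurably on the parameters. Joint measurability is what allows the use of Fubini next. -/
theorem measurable_leftDeriv (h : HasParallelBox u₀ v₀ F H G f) :
    Measurable fun x : ℝ × ℝ => leftDeriv F G x.1 x.2 := by
  have h1 : ∀ s : Set ((ℝ × ℝ) × ℝ), MeasurableSet s →
      Measurable fun x : ℝ × ℝ => ∫ z, s.indicator (fun y => G (y.1.1, y.2)) (x, z) := by
    intro s hs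
    have : StronglyMeasurable (s.indicator fun y : (ℝ × ℝ) × ℝ => G (y.1.1, y.2)) :=
      (h.stronglyMeasurable.comp_measurable (by fun_prop)).indicator hs
    exact this.integral_prod_right'.measurable
  have e : ∀ x : ℝ × ℝ, leftDeriv F G x.1 x.2 = deriv F x.1 -
      ((∫ z, {y : (ℝ × ℝ) × ℝ | 0 < y.2 ∧ y.2 ≤ y.1.2}.indicator
          (fun y => G (y.1.1, y.2)) (x, z)) -
        ∫ z, {y : (ℝ × ℝ) × ℝ | y.1.2 < y.2 ∧ y.2 ≤ 0}.indicator
          (fun y => G (y.1.1, y.2)) (x, z)) := by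
    intro x
    rw [leftDeriv, intervalIntegral, ← integral_indicator measurableSet_Ioc,
      ← integral_indicator measurableSet_Ioc]
    rfl
  simp_rw [e]
  refine ((measurable_deriv F).comp measurable_fst).sub ((h1 _ ?_).sub (h1 _ ?_))
  · exact (measurableSet_lt measurable_const measurable_snd).inter
      (measurableSet_le measurable_snd (by fun_prop))
  · exact (measurableSet_lt (by fun_prop) measurable_snd).inter
      (measurableSet_le measurable_snd measurable_const)

/-- The classical derivative in the first variable is given by the integral representation. -/
theorem ae_prod_hasDerivAt_left (h : HasParallelBox u₀ v₀ F H G f) :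
    ∀ᵐ x : ℝ × ℝ, x.1 ∈ Icc 0 u₀ → x.2 ∈ Icc 0 v₀ →
      HasDerivAt (fun w => f w x.2) (leftDeriv F G x.1 x.2) x.1 := by
  have hf' : Continuous (fun v u => f u v).uncurry := h.continuous.comp continuous_swap
  have m1 : MeasurableSet {x : ℝ × ℝ | DifferentiableAt ℝ (fun w => f w x.1) x.2} :=
    measurableSet_of_differentiableAt_with_param ℝ hf'
  have m2 : MeasurableSet {x : ℝ × ℝ | deriv (fun w => f w x.1) x.2 = leftDeriv F G x.2 x.1} :=
    measurableSet_eq_fun (measurable_deriv_with_param hf')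
      (h.measurable_leftDeriv.comp measurable_swap)
  have m3 : MeasurableSet {x : ℝ × ℝ | x.2 ∈ Icc 0 u₀ → x.1 ∈ Icc 0 v₀ →
      HasDerivAt (fun w => f w x.1) (leftDeriv F G x.2 x.1) x.2} := by
    have : {x : ℝ × ℝ | x.2 ∈ Icc 0 u₀ → x.1 ∈ Icc 0 v₀ →
        HasDerivAt (fun w => f w x.1) (leftDeriv F G x.2 x.1) x.2} =
        (Prod.snd ⁻¹' Icc 0 u₀ ∩ Prod.fst ⁻¹' Icc 0 v₀)ᶜ ∪
        ({x : ℝ × ℝ | DifferentiableAt ℝ (fun w => f w x.1) x.2} ∩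
          {x : ℝ × ℝ | deriv (fun w => f w x.1) x.2 = leftDeriv F G x.2 x.1}) := by
      ext x
      have : HasDerivAt (fun w => f w x.1) (leftDeriv F G x.2 x.1) x.2 ↔
          DifferentiableAt ℝ (fun w => f w x.1) x.2 ∧
            deriv (fun w => f w x.1) x.2 = leftDeriv F G x.2 x.1 :=
        ⟨fun h => ⟨h.differentiableAt, h.deriv⟩, fun h => h.2 ▸ h.1.hasDerivAt⟩
      simp only [mem_ofPred_eq, this, mem_union, mem_compl_iff, mem_inter_iff, mem_preimage]
      tauto
    rw [this]
    exact ((measurable_snd measurableSet_Icc).inter (measurable_fst measurableSet_Icc)).compl.union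
      (m1.inter m2)
  -- Slices are controlled for fixed `v`, so Fubini is applied with `v` as the outer variable and
  -- the coordinates are exchanged at the end.
  have key : ∀ᵐ x : ℝ × ℝ, x.2 ∈ Icc 0 u₀ → x.1 ∈ Icc 0 v₀ →
      HasDerivAt (fun w => f w x.1) (leftDeriv F G x.2 x.1) x.2 := by
    rw [Measure.volume_eq_prod, Measure.ae_prod_iff_ae_ae m3]
    refine .of_forall fun v => ?_
    by_cases hv : v ∈ Icc 0 v₀
    · filter_upwards [h.ae_hasDerivAt_left hv] with w hw hw' _ using hw hw'
    · exact .of_forall fun _ _ h => absurd h hv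
  exact Measure.measurePreserving_swap.quasiMeasurePreserving.ae
    (p := fun x : ℝ × ℝ => x.2 ∈ Icc 0 u₀ → x.1 ∈ Icc 0 v₀ →
      HasDerivAt (fun w => f w x.1) (leftDeriv F G x.2 x.1) x.2) key

/-- Conservation of the norm of the derivative in the first variable along the second one. -/
theorem ae_norm_leftDeriv (h : HasParallelBox u₀ v₀ F H G f) :
    ∀ᵐ w, w ∈ Icc 0 u₀ → ∀ v ∈ Icc 0 v₀, ‖leftDeriv F G w v‖ = ‖deriv F w‖ := by
  have h1 := Measure.ae_ae_of_ae_prod (μ := (volume : Measure ℝ)) (ν := (volume : Measure ℝ))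
    h.ae_prod_hasDerivAt_left
  have hint : Integrable G ((volume : Measure ℝ).prod (volume : Measure ℝ)) := h.integrable
  filter_upwards [h1, hint.prod_right_ae, Measure.ae_ne volume 0, Measure.ae_ne volume u₀]
    with w h2 h3 w0 w1 hw v hv
  have hv₀ : 0 ≤ v₀ := hv.1.trans hv.2
  have hII : IntervalIntegrable (fun z => G (w, z)) volume 0 v₀ := h3.intervalIntegrable
  have hac : AbsolutelyContinuousOnInterval (fun v => leftDeriv F G w v) 0 v₀ :=
    hII.absolutelyContinuousOnInterval_primitive.of_dist_le (C := 1) fun x _ y _ => by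
      rw [one_mul, leftDeriv, leftDeriv, dist_sub_left]
  -- An absolutely continuous function is bounded on the interval, so its squared norm is absolutely
  -- continuous too.
  have hac2 : AbsolutelyContinuousOnInterval (fun v => ‖leftDeriv F G w v‖ ^ 2) 0 v₀ := by
    obtain ⟨C, hC⟩ := hac.exists_bound
    refine hac.of_dist_le (C := C + C) fun x hx y hy => ?_
    rw [Real.dist_eq, sq_sub_sq, abs_mul]
    refine mul_le_mul ?_ ?_ (abs_nonneg _) ?_
    · rw [abs_of_nonneg (by positivity)]
      exact add_le_add (hC x hx) (hC y hy)
    · rw [dist_eq_norm]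
      exact abs_norm_sub_norm_le _ _
    · have := (norm_nonneg _).trans (hC x hx)
      linarith
  obtain ⟨K, hK⟩ := hac2.const_of_ae_hasDerivAt_zero (by
    filter_upwards [h2, hII.ae_hasDerivAt_integral] with z h4 h5 hz
    have hd : HasDerivAt (fun v => leftDeriv F G w v) (-G (w, z)) z :=
      (h5 hz 0 left_mem_uIcc).const_sub _
    have hsq := hd.norm_sq
    rw [uIcc_of_le hv₀] at hz
    obtain ⟨c, hc⟩ := h.parallel (w, z)
    -- Differentiating `|f|² = 1` in the first variable; as `G` is parallel to `f`, the squared norm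
    -- of `leftDeriv` has derivative zero almost everywhere.
    have orth : inner ℝ (f w z) (leftDeriv F G w z) = 0 := by
      have e1 := (h4 hw hz).norm_sq
      have e2 : HasDerivAt (fun w => ‖f w z‖ ^ 2) 0 w := by
        refine (hasDerivAt_const w (1 : ℝ)).congr_of_eventuallyEq ?_
        filter_upwards [Ioo_mem_nhds (lt_of_le_of_ne hw.1 w0.symm) (lt_of_le_of_ne hw.2 w1)]
          with x hx
        rw [h.norm_eq_one x (Ioo_subset_Icc_self hx) z hz, one_pow]
      have := e1.unique e2
      simpa using this
    rw [hc, ← neg_smul, inner_smul_right, real_inner_comm, orth, mul_zero, mul_zero] at hsq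
    exact hsq)
  rw [uIcc_of_le hv₀] at hK
  have e0 := hK 0 ⟨le_rfl, hv₀⟩
  have ev := hK v hv
  have : leftDeriv F G w 0 = deriv F w := by simp [leftDeriv]
  rw [← e0] at ev
  simp only [this] at ev
  exact (sq_eq_sq₀ (norm_nonneg _) (norm_nonneg _)).1 ev

theorem norm_sub_le_integral (h : HasParallelBox u₀ v₀ F H G f) {u u' v : ℝ} (hu : 0 ≤ u)
    (huu : u ≤ u') (hu' : u' ≤ u₀) (hv : v ∈ Icc 0 v₀) :
    ‖f u' v - f u v‖ ≤ ∫ w in u..u', ‖deriv F w‖ := by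
  rw [← h.integral_leftDeriv ⟨hu, huu.trans hu'⟩ ⟨hu.trans huu, hu'⟩ hv]
  refine intervalIntegral.norm_integral_le_of_norm_le huu ?_ (h.intervalIntegrable_deriv _ _).norm
  filter_upwards [h.ae_norm_leftDeriv] with w hw hwu
  exact (hw ⟨hu.trans hwu.1.le, hwu.2.trans hu'⟩ v hv).le

theorem ae_leftDeriv_sub (h : HasParallelBox u₀ v₀ F H G f) :
    ∀ᵐ w, ∀ v v', leftDeriv F G w v' - leftDeriv F G w v = -∫ z in v..v', G (w, z) := by
  have hint : Integrable G ((volume : Measure ℝ).prod (volume : Measure ℝ)) := h.integrable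
  filter_upwards [hint.prod_right_ae] with w hw v v'
  rw [← intervalIntegral.integral_interval_sub_left (a := 0) hw.intervalIntegrable
    hw.intervalIntegrable]
  simp [leftDeriv]

theorem ae_norm_leftDeriv_sub_le (h : HasParallelBox u₀ v₀ F H G f) {q : ℝ → ℝ}
    (hq : ∀ a b, IntervalIntegrable q volume a b)
    (hG : ∀ᵐ x : ℝ × ℝ, x.1 ∈ Icc 0 u₀ → x.2 ∈ Icc 0 v₀ → ‖G x‖ ≤ ‖deriv F x.1‖ * q x.2) :
    ∀ᵐ w, w ∈ Icc 0 u₀ → ∀ v v', 0 ≤ v → v ≤ v' → v' ≤ v₀ →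
      ‖leftDeriv F G w v' - leftDeriv F G w v‖ ≤ ‖deriv F w‖ * ∫ z in v..v', q z := by
  have hG' := Measure.ae_ae_of_ae_prod (μ := (volume : Measure ℝ)) (ν := (volume : Measure ℝ)) hG
  filter_upwards [h.ae_leftDeriv_sub, hG'] with w h1 h2 hw v v' hv hvv hv'
  rw [h1, norm_neg, ← intervalIntegral.integral_const_mul]
  refine intervalIntegral.norm_integral_le_of_norm_le hvv ?_ ((hq _ _).const_mul _)
  filter_upwards [h2] with z hz hzv
  exact hz hw ⟨hv.trans hzv.1.le, hzv.2.trans hv'⟩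

end HasParallelBox

theorem intervalIntegrable_clm_comp {F₁ F₂ : Type*} [NormedAddCommGroup F₁] [NormedSpace ℝ F₁]
    [NormedAddCommGroup F₂] [NormedSpace ℝ F₂] (L : F₁ →L[ℝ] F₂) {g : ℝ → F₁} {a b : ℝ}
    (hg : IntervalIntegrable g volume a b) : IntervalIntegrable (fun x => L (g x)) volume a b :=
  ⟨L.integrable_comp hg.1, L.integrable_comp hg.2⟩

namespace HasParallelBox

variable {d : ℕ} {u₀ v₀ : ℝ} {F H F' H' : ℝ → E d} {G : ℝ × ℝ → E d} {f : ℝ → ℝ → E d}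

/-- Replaces classical derivatives by the versions from the integral representations, which are
regular along almost every line. -/
theorem ae_eq_inner_smul (h : HasParallelBox u₀ v₀ F H G f)
    (h' : HasParallelBox v₀ u₀ F' H' (G ∘ Prod.swap) (fun v u => f u v))
    (hG : ∀ u ∈ Icc 0 u₀, ∀ v ∈ Icc 0 v₀, G (u, v) = nullForm f u v • f u v) :
    ∀ᵐ x : ℝ × ℝ, x.1 ∈ Icc 0 u₀ → x.2 ∈ Icc 0 v₀ →
      G x = inner ℝ (leftDeriv F G x.1 x.2) (leftDeriv F' (G ∘ Prod.swap) x.2 x.1) •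
        f x.1 x.2 := by
  have h2 := Measure.measurePreserving_swap.quasiMeasurePreserving.ae
    (p := fun x : ℝ × ℝ => x.1 ∈ Icc 0 v₀ → x.2 ∈ Icc 0 u₀ →
      HasDerivAt (fun w => f x.2 w) (leftDeriv F' (G ∘ Prod.swap) x.1 x.2) x.1)
    h'.ae_prod_hasDerivAt_left
  filter_upwards [h.ae_prod_hasDerivAt_left, h2] with x h3 h4 hx1 hx2
  have h4' : HasDerivAt (fun z => f x.1 z) (leftDeriv F' (G ∘ Prod.swap) x.2 x.1) x.2 :=
    h4 hx2 hx1
  rw [← (h3 hx1 hx2).deriv, ← h4'.deriv]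
  exact hG _ hx1 _ hx2

/-- Cauchy–Schwarz with the conservation law in both variables: mere integrability of the null form
improves to a product bound by the boundary speeds. -/
theorem ae_norm_le (h : HasParallelBox u₀ v₀ F H G f)
    (h' : HasParallelBox v₀ u₀ F' H' (G ∘ Prod.swap) (fun v u => f u v))
    (hG : ∀ u ∈ Icc 0 u₀, ∀ v ∈ Icc 0 v₀, G (u, v) = nullForm f u v • f u v) :
    ∀ᵐ x : ℝ × ℝ, x.1 ∈ Icc 0 u₀ → x.2 ∈ Icc 0 v₀ →
      ‖G x‖ ≤ ‖deriv F x.1‖ * ‖deriv F' x.2‖ := by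
  have h1 := Measure.quasiMeasurePreserving_fst (μ := (volume : Measure ℝ))
    (ν := (volume : Measure ℝ)).ae h.ae_norm_leftDeriv
  have h2 := Measure.quasiMeasurePreserving_snd (μ := (volume : Measure ℝ))
    (ν := (volume : Measure ℝ)).ae h'.ae_norm_leftDeriv
  filter_upwards [h1, h2, h.ae_eq_inner_smul h' hG] with x h3 h4 h5 hx1 hx2
  rw [h5 hx1 hx2, ← h3 hx1 _ hx2, ← h4 hx2 _ hx1]
  exact (norm_inner_smul_le le_rfl le_rfl (h.norm_eq_one _ hx1 _ hx2).le).trans_eq (mul_one _)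

section Rectangle

variable {u u' v v' : ℝ}

theorem box_eq_integral (h : HasParallelBox u₀ v₀ F H G f) (hu : 0 ≤ u) (huu : u ≤ u')
    (hu' : u' ≤ u₀) (hv : 0 ≤ v) (hvv : v ≤ v') (hv' : v' ≤ v₀) :
    f u' v' - f u' v - f u v' + f u v =
      ∫ w in u..u', (leftDeriv F G w v' - leftDeriv F G w v) := by
  rw [intervalIntegral.integral_sub (h.intervalIntegrable_leftDeriv _ _ _)
    (h.intervalIntegrable_leftDeriv _ _ _),
    h.integral_leftDeriv ⟨hu, huu.trans hu'⟩ ⟨hu.trans huu, hu'⟩ ⟨hv.trans hvv, hv'⟩,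
    h.integral_leftDeriv ⟨hu, huu.trans hu'⟩ ⟨hu.trans huu, hu'⟩ ⟨hv, hvv.trans hv'⟩]
  abel

theorem norm_box_le (h : HasParallelBox u₀ v₀ F H G f)
    (h' : HasParallelBox v₀ u₀ F' H' (G ∘ Prod.swap) (fun v u => f u v))
    (hG : ∀ u ∈ Icc 0 u₀, ∀ v ∈ Icc 0 v₀, G (u, v) = nullForm f u v • f u v)
    (hu : 0 ≤ u) (huu : u ≤ u') (hu' : u' ≤ u₀) (hv : 0 ≤ v) (hvv : v ≤ v') (hv' : v' ≤ v₀) :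
    ‖f u' v' - f u' v - f u v' + f u v‖ ≤
      (∫ w in u..u', ‖deriv F w‖) * ∫ z in v..v', ‖deriv F' z‖ := by
  rw [h.box_eq_integral hu huu hu' hv hvv hv', ← intervalIntegral.integral_mul_const]
  refine intervalIntegral.norm_integral_le_of_norm_le huu ?_
    ((h.intervalIntegrable_deriv _ _).norm.mul_const _)
  filter_upwards [h.ae_norm_leftDeriv_sub_le (fun a b => (h'.intervalIntegrable_deriv a b).norm)
    (h.ae_norm_le h' hG)] with w hw hwu
  exact hw ⟨hu.trans hwu.1.le, hwu.2.trans hu'⟩ v v' hv hvv hv'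

/-- The corrected mixed difference is a double integral of `G` minus its value frozen at the lower
left corner. Freezing `∂_u f`, `∂_v f` and `f` costs `p q ΔQ`, `p q ΔP` and `p q (ΔP + ΔQ)`, which
add up to the constant 2. -/
theorem norm_box_add_le (h : HasParallelBox u₀ v₀ F H G f)
    (h' : HasParallelBox v₀ u₀ F' H' (G ∘ Prod.swap) (fun v u => f u v))
    (hG : ∀ u ∈ Icc 0 u₀, ∀ v ∈ Icc 0 v₀, G (u, v) = nullForm f u v • f u v)
    (hu : 0 ≤ u) (huu : u ≤ u') (hu' : u' ≤ u₀) (hv : 0 ≤ v) (hvv : v ≤ v') (hv' : v' ≤ v₀) :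
    ‖f u' v' - f u' v - f u v' + f u v
        + inner ℝ (f u' v - f u v) (f u v' - f u v) • f u v‖ ≤
      2 * (∫ w in u..u', ‖deriv F w‖) * (∫ z in v..v', ‖deriv F' z‖) *
        ((∫ w in u..u', ‖deriv F w‖) + ∫ z in v..v', ‖deriv F' z‖) := by
  set p := fun w => ‖deriv F w‖ with hp
  set q := fun z => ‖deriv F' z‖ with hq
  have ip : ∀ a b, IntervalIntegrable p volume a b := fun a b =>
    (h.intervalIntegrable_deriv a b).norm
  have iq : ∀ a b, IntervalIntegrable q volume a b := fun a b =>
    (h'.intervalIntegrable_deriv a b).norm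
  set ΔP := ∫ w in u..u', p w with hΔP
  set ΔQ := ∫ z in v..v', q z with hΔQ
  have p_le : ∀ w, u ≤ w → w ≤ u' → ∫ x in u..w, p x ≤ ΔP := fun w h1 h2 =>
    intervalIntegral.integral_mono_interval le_rfl h1 h2 (.of_forall fun _ => norm_nonneg _)
      (ip _ _)
  have q_le : ∀ z, v ≤ z → z ≤ v' → ∫ x in v..z, q x ≤ ΔQ := fun z h1 h2 =>
    intervalIntegral.integral_mono_interval le_rfl h1 h2 (.of_forall fun _ => norm_nonneg _)
      (iq _ _)
  have hvm : v ∈ Icc 0 v₀ := ⟨hv, hvv.trans hv'⟩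
  have hum : u ∈ Icc 0 u₀ := ⟨hu, huu.trans hu'⟩
  have hvm' : v' ∈ Icc 0 v₀ := ⟨hv.trans hvv, hv'⟩
  have hum' : u' ∈ Icc 0 u₀ := ⟨hu.trans huu, hu'⟩
  set a := leftDeriv F G with ha
  set b := leftDeriv F' (G ∘ Prod.swap) with hb
  have hβ : ∫ z in v..v', b z u = f u v' - f u v := h'.integral_leftDeriv hvm hvm' hum
  have hα : ∫ w in u..u', a w v = f u' v - f u v := h.integral_leftDeriv hum hum' hvm
  set β := f u v' - f u v
  -- The frozen product is linear in each side, so it can be moved under the integral, first in `w`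
  -- through `L`, then in `z` through `M`.
  set L : E d →L[ℝ] E d := (innerSL ℝ β).smulRight (f u v) with hL
  have ia : ∀ v, IntervalIntegrable (fun w => a w v) volume u u' := fun v =>
    h.intervalIntegrable_leftDeriv u u' v
  have ib : ∀ u, IntervalIntegrable (fun z => b z u) volume v v' := fun u =>
    h'.intervalIntegrable_leftDeriv v v' u
  have hGn := h.ae_norm_le h' hG
  have hGn' : ∀ᵐ x : ℝ × ℝ, x.1 ∈ Icc 0 v₀ → x.2 ∈ Icc 0 u₀ →
      ‖(G ∘ Prod.swap) x‖ ≤ ‖deriv F' x.1‖ * p x.2 := by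
    filter_upwards [Measure.measurePreserving_swap.quasiMeasurePreserving.ae
      (p := fun x : ℝ × ℝ => x.1 ∈ Icc 0 u₀ → x.2 ∈ Icc 0 v₀ →
        ‖G x‖ ≤ ‖deriv F x.1‖ * ‖deriv F' x.2‖) hGn] with x hx h1 h2
    rw [mul_comm]
    exact hx h2 h1
  have e1 : f u' v' - f u' v - f u v' + f u v + inner ℝ (f u' v - f u v) β • f u v =
      ∫ w in u..u', ((a w v' - a w v) + L (a w v)) := by
    rw [intervalIntegral.integral_add ((ia _).sub (ia _)) (intervalIntegrable_clm_comp L (ia v)),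
      L.intervalIntegral_comp_comm (ia v), ← h.box_eq_integral hu huu hu' hv hvv hv', hα, hL]
    simp [real_inner_comm]
  have e2 : 2 * ΔP * ΔQ * (ΔP + ΔQ) = ∫ w in u..u', p w * (ΔQ * (2 * (ΔP + ΔQ))) := by
    rw [intervalIntegral.integral_mul_const]
    ring
  rw [e1, e2]
  refine intervalIntegral.norm_integral_le_of_norm_le huu ?_ ((ip _ _).mul_const _)
  have hint : Integrable G ((volume : Measure ℝ).prod (volume : Measure ℝ)) := h.integrable
  filter_upwards [h.ae_leftDeriv_sub, h.ae_norm_leftDeriv, h.ae_norm_leftDeriv_sub_le iq hGn,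
    hint.prod_right_ae, Measure.ae_ae_of_ae_prod (μ := (volume : Measure ℝ))
      (ν := (volume : Measure ℝ)) (h.ae_eq_inner_smul h' hG)] with w k1 k2 k3 k4 k5 hw
  have hwm : w ∈ Icc 0 u₀ := ⟨hu.trans hw.1.le, hw.2.trans hu'⟩
  set M : E d →L[ℝ] E d := (innerSL ℝ (a w v)).smulRight (f u v) with hM
  have e3 : (a w v' - a w v) + L (a w v) =
      ∫ z in v..v', (-G (w, z) + M (b z u)) := by
    have k4' : IntervalIntegrable (fun z => -G (w, z)) volume v v' := k4.intervalIntegrable.neg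
    rw [intervalIntegral.integral_add k4' (intervalIntegrable_clm_comp M (ib u)),
      M.intervalIntegral_comp_comm (ib u), intervalIntegral.integral_neg, ← k1, hβ]
    have hLM : L (a w v) = M β := by simp [hL, hM, real_inner_comm]
    exact congrArg (a w v' - a w v + ·) hLM
  have e4 : p w * (ΔQ * (2 * (ΔP + ΔQ))) = ∫ z in v..v', q z * (p w * (2 * (ΔP + ΔQ))) := by
    rw [intervalIntegral.integral_mul_const]
    ring
  rw [e3, e4]
  refine intervalIntegral.norm_integral_le_of_norm_le hvv ?_ ((iq _ _).mul_const _)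
  filter_upwards [k5, h'.ae_norm_leftDeriv, h'.ae_norm_leftDeriv_sub_le ip hGn'] with z l1 l2 l3 hz
  have hzm : z ∈ Icc 0 v₀ := ⟨hv.trans hz.1.le, hz.2.trans hv'⟩
  -- Telescoping: the three factors are replaced one at a time by their frozen values.
  have e5 : -G (w, z) + M (b z u) = -(inner ℝ (a w z - a w v) (b z w) • f w z
      + inner ℝ (a w v) (b z w - b z u) • f w z + inner ℝ (a w v) (b z u) • (f w z - f u v)) := by
    rw [l1 hwm hzm, hM]
    simp only [ContinuousLinearMap.smulRight_apply, innerSL_apply_apply, inner_sub_left,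
      inner_sub_right, ← ha, ← hb]
    module
  have n1 : ‖a w z - a w v‖ ≤ p w * ΔQ :=
    (k3 hwm v z hv hz.1.le (hz.2.trans hv')).trans
      (mul_le_mul_of_nonneg_left (q_le z hz.1.le hz.2) (norm_nonneg _))
  have n2 : ‖b z w - b z u‖ ≤ q z * ΔP :=
    (l3 hzm u w hu hw.1.le (hw.2.trans hu')).trans
      (mul_le_mul_of_nonneg_left (p_le w hw.1.le hw.2) (norm_nonneg _))
  have n3 : ‖f w z - f u v‖ ≤ ΔP + ΔQ := by
    rw [← sub_add_sub_cancel _ (f u z)]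
    refine (norm_add_le _ _).trans (add_le_add ?_ ?_)
    · exact (h.norm_sub_le_integral hu hw.1.le (hw.2.trans hu') hzm).trans (p_le w hw.1.le hw.2)
    · exact (h'.norm_sub_le_integral hv hz.1.le (hz.2.trans hv') hum).trans (q_le z hz.1.le hz.2)
  have fn := (h.norm_eq_one w hwm z hzm).le
  rw [e5, norm_neg]
  refine (norm_add₃_le.trans (add_le_add (add_le_add
    (norm_inner_smul_le n1 (l2 hzm w hwm).le fn)
    (norm_inner_smul_le (k2 hwm v hvm).le n2 fn))
    (norm_inner_smul_le (k2 hwm v hvm).le (l2 hzm u hum).le n3))).trans_eq ?_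
  simp only [hp, hq]
  ring

end Rectangle

end HasParallelBox

/-! ### Well-posedness for absolutely continuous boundary data -/

section Uniqueness

variable {d : ℕ} {φp φm : X₁ d} {ψ : X₂ d}

theorem IsWaveMap.apply_zero_right (h : IsWaveMap φp φm ψ) (h0 : φm 0 = φp 0) (u : ℝ≥0) :
    ψ (u, 0) = φp u := by
  have hu : (0 : ℝ) < u + 1 := by positivity
  have := (h (u + 1) 1 hu one_pos).eq_integral u ⟨u.coe_nonneg, by simp⟩ 0 ⟨le_rfl, zero_le_one⟩
  refine Subtype.ext ?_
  simpa [lift₁, lift₂, h0] using this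

theorem IsWaveMap.apply_zero_left (h : IsWaveMap φp φm ψ) (v : ℝ≥0) :
    ψ (0, v) = φm v := by
  have hv : (0 : ℝ) < v + 1 := by positivity
  have := (h 1 (v + 1) one_pos hv).eq_integral 0 ⟨le_rfl, zero_le_one⟩ v ⟨v.coe_nonneg, by simp⟩
  refine Subtype.ext ?_
  simpa [lift₁, lift₂] using this

/-- The nonlinearity on a rectangle, extended by zero. -/
def cutNonlinearity (u₀ v₀ : ℝ) (f : ℝ → ℝ → E d) : ℝ × ℝ → E d :=
  (Icc 0 u₀ ×ˢ Icc 0 v₀).indicator fun x => nullForm f x.1 x.2 • f x.1 x.2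

theorem cutNonlinearity_of_mem {u₀ v₀ u v : ℝ} (f : ℝ → ℝ → E d) (hu : u ∈ Icc 0 u₀)
    (hv : v ∈ Icc 0 v₀) : cutNonlinearity u₀ v₀ f (u, v) = nullForm f u v • f u v :=
  indicator_of_mem (mk_mem_prod hu hv) _

theorem cutNonlinearity_parallel {u₀ v₀ : ℝ} (f : ℝ → ℝ → E d) (x : ℝ × ℝ) :
    ∃ c : ℝ, cutNonlinearity u₀ v₀ f x = c • f x.1 x.2 := by
  by_cases hx : x ∈ Icc 0 u₀ ×ˢ Icc 0 v₀
  · exact ⟨_, indicator_of_mem hx _⟩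
  · exact ⟨0, by rw [zero_smul]; exact indicator_of_notMem hx _⟩

theorem stronglyMeasurable_cutNonlinearity (u₀ v₀ : ℝ) {f : ℝ → ℝ → E d}
    (hf : Continuous f.uncurry) : StronglyMeasurable (cutNonlinearity u₀ v₀ f) := by
  have hf' : Continuous (fun v u => f u v).uncurry := hf.comp continuous_swap
  have hmeas : Measurable fun x : ℝ × ℝ => nullForm f x.1 x.2 :=
    Measurable.inner ((measurable_deriv_with_param hf').comp measurable_swap)
      (measurable_deriv_with_param hf)
  exact ((hmeas.smul hf.measurable).indicator
    (measurableSet_Icc.prod measurableSet_Icc)).stronglyMeasurable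

theorem IsWaveMapOn.integrable_cutNonlinearity {u₀ v₀ : ℝ} {fp fm : ℝ → E d} {f : ℝ → ℝ → E d}
    (h : IsWaveMapOn u₀ v₀ fp fm f) (hf : Continuous f.uncurry) :
    Integrable (cutNonlinearity u₀ v₀ f) := by
  have hR : MeasurableSet (Icc 0 u₀ ×ˢ Icc 0 v₀) := measurableSet_Icc.prod measurableSet_Icc
  rw [cutNonlinearity, integrable_indicator_iff hR]
  refine h.integrable.smul_of_top_left (memLp_top_of_bound hf.aestronglyMeasurable 1 ?_)
  rw [ae_restrict_iff' hR]
  exact .of_forall fun x hx => (h.norm_eq_one _ hx.1 _ hx.2).le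

theorem IsWaveMapOn.eq_integral_cutNonlinearity {u₀ v₀ : ℝ} {fp fm : ℝ → E d} {f : ℝ → ℝ → E d}
    (h : IsWaveMapOn u₀ v₀ fp fm f) {u v : ℝ} (hu : u ∈ Icc 0 u₀) (hv : v ∈ Icc 0 v₀) :
    f u v = fp u + fm v - fp 0 -
      ∫ w in (0 : ℝ)..u, ∫ z in (0 : ℝ)..v, cutNonlinearity u₀ v₀ f (w, z) := by
  rw [h.eq_integral u hu v hv]
  congr 1
  refine intervalIntegral.integral_congr fun w hw => intervalIntegral.integral_congr fun z hz => ?_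
  rw [uIcc_of_le hu.1] at hw
  rw [uIcc_of_le hv.1] at hz
  exact (cutNonlinearity_of_mem f ⟨hw.1, hw.2.trans hu.2⟩ ⟨hz.1, hz.2.trans hv.2⟩).symm

theorem IsWaveMap.hasParallelBox_left (h : IsWaveMap φp φm ψ) (hp : LocallyAC φp) {u₀ v₀ : ℝ}
    (hu : 0 < u₀) (hv : 0 < v₀) :
    HasParallelBox u₀ v₀ (lift₁ φp) (fun v => lift₁ φm v - lift₁ φp 0)
      (cutNonlinearity u₀ v₀ (lift₂ ψ)) (lift₂ ψ) where
  norm_eq_one := (h u₀ v₀ hu hv).norm_eq_one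
  continuous := continuous_lift₂ ψ
  stronglyMeasurable := stronglyMeasurable_cutNonlinearity _ _ (continuous_lift₂ ψ)
  integrable := (h u₀ v₀ hu hv).integrable_cutNonlinearity (continuous_lift₂ ψ)
  parallel x := cutNonlinearity_parallel (lift₂ ψ) x
  intervalIntegrable_deriv := hp.intervalIntegrable_deriv
  integral_deriv _ hu := hp.integral_deriv le_rfl hu.1
  eq_integral u hu' v hv' := by
    rw [(h u₀ v₀ hu hv).eq_integral_cutNonlinearity hu' hv', add_sub_assoc]

theorem IsWaveMap.hasParallelBox_right (h : IsWaveMap φp φm ψ) (hm : LocallyAC φm) {u₀ v₀ : ℝ}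
    (hu : 0 < u₀) (hv : 0 < v₀) :
    HasParallelBox v₀ u₀ (lift₁ φm) (fun u => lift₁ φp u - lift₁ φp 0)
      (cutNonlinearity u₀ v₀ (lift₂ ψ) ∘ Prod.swap) (fun v u => lift₂ ψ u v) where
  norm_eq_one v hv' u hu' := (h u₀ v₀ hu hv).norm_eq_one u hu' v hv'
  continuous := (continuous_lift₂ ψ).comp continuous_swap
  stronglyMeasurable := (stronglyMeasurable_cutNonlinearity _ _
    (continuous_lift₂ ψ)).comp_measurable measurable_swap
  integrable := ((h u₀ v₀ hu hv).integrable_cutNonlinearity (continuous_lift₂ ψ)).swap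
  parallel x := cutNonlinearity_parallel (lift₂ ψ) x.swap
  intervalIntegrable_deriv := hm.intervalIntegrable_deriv
  integral_deriv _ hu := hm.integral_deriv le_rfl hu.1
  eq_integral v hv' u hu' := by
    have := intervalIntegral_intervalIntegral_swap (a := 0) (b := u) (c := 0) (d := v)
      (F := fun w z => cutNonlinearity u₀ v₀ (lift₂ ψ) (w, z))
      ((h u₀ v₀ hu hv).integrable_cutNonlinearity (continuous_lift₂ ψ)).integrableOn
    rw [(h u₀ v₀ hu hv).eq_integral_cutNonlinearity hu' hv', this]
    simp only [Function.comp, Prod.swap_prod_mk]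
    abel

/-- A wave map is controlled by the lengths of its boundary data. -/
theorem IsWaveMap.rectControl (h : IsWaveMap φp φm ψ) (hp : LocallyAC φp) (hm : LocallyAC φm) :
    RectControl (pathLength φp) (pathLength φm) (fun u v => (ψ (u, v) : E d)) := by
  -- The sides are enlarged by 1 to stay positive when a corner lies on the axes.
  have L := fun (u₀ v₀ : ℝ≥0) => h.hasParallelBox_left hp (u₀ := u₀ + 1) (v₀ := v₀ + 1)
    (by positivity) (by positivity)
  have R := fun (u₀ v₀ : ℝ≥0) => h.hasParallelBox_right hm (u₀ := u₀ + 1) (v₀ := v₀ + 1)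
    (by positivity) (by positivity)
  have e : ∀ u v : ℝ≥0, lift₂ ψ u v = ψ (u, v) := fun u v => by simp [lift₂]
  have p0 : ∀ ⦃u u' : ℝ≥0⦄, u ≤ u' → 0 ≤ pathLength φp u' - pathLength φp u := fun u u' hu =>
    sub_nonneg.2 (hp.monotone_pathLength hu)
  have q0 : ∀ ⦃v v' : ℝ≥0⦄, v ≤ v' → 0 ≤ pathLength φm v' - pathLength φm v := fun v v' hv =>
    sub_nonneg.2 (hm.monotone_pathLength hv)
  refine ⟨fun u v => by simp, fun u u' hu v => ?_, fun u v v' hv => ?_, fun u u' hu v v' hv => ?_,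
    fun u u' hu v v' hv => ?_⟩
  · rw [hp.pathLength_sub, ← e, ← e]
    exact (L u' v).norm_sub_le_integral u.coe_nonneg hu (by simp) ⟨v.coe_nonneg, by simp⟩
  · rw [hm.pathLength_sub, ← e, ← e]
    exact (R u v').norm_sub_le_integral v.coe_nonneg hv (by simp) ⟨u.coe_nonneg, by simp⟩
  · have := (L u' v').norm_box_le (R u' v')
      (fun _ hu _ hv => cutNonlinearity_of_mem _ hu hv) u.coe_nonneg (NNReal.coe_le_coe.2 hu)
      (by simp) v.coe_nonneg (NNReal.coe_le_coe.2 hv) (by simp)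
    rw [← hp.pathLength_sub, ← hm.pathLength_sub, e, e, e, e] at this
    refine this.trans ?_
    -- Wave maps satisfy the bound with constant 1 instead of 17, and below with 2 instead of 22;
    -- the larger constants are those of the scheme.
    have := mul_nonneg (p0 hu) (q0 hv)
    linarith
  · have := (L u' v').norm_box_add_le (R u' v')
      (fun _ hu _ hv => cutNonlinearity_of_mem _ hu hv) u.coe_nonneg (NNReal.coe_le_coe.2 hu)
      (by simp) v.coe_nonneg (NNReal.coe_le_coe.2 hv) (by simp)
    rw [← hp.pathLength_sub, ← hm.pathLength_sub, e, e, e, e] at this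
    refine this.trans ?_
    have := mul_nonneg (mul_nonneg (p0 hu) (q0 hv)) (add_nonneg (p0 hu) (q0 hv))
    linarith

theorem incl_injective : Function.Injective (incl (d := d)) := fun _ _ h =>
  ContinuousMap.ext fun p => Subtype.ext (DFunLike.congr_fun h p)

/-- Well-posedness for absolutely continuous boundary data, and convergence of the scheme. -/
theorem exists_isWaveMap (hp : LocallyAC φp) (hm : LocallyAC φm) (h0 : φm 0 = φp 0) :
    ∃ φ, IsWaveMap φp φm φ ∧ (∀ ψ, IsWaveMap φp φm ψ → ψ = φ) ∧
      Tendsto (fun N => numericalScheme N φp φm) atTop (𝓝 (incl φ)) := by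
  have hb := hp.boundaryControl hm h0
  obtain ⟨φ, hφ, h1, h2⟩ := hb.exists_rectControl
  have ht := hb.tendsto_numericalScheme hφ h1 h2
  -- Uniqueness: any wave map is controlled, so it is a limit of the same sequence of
  -- approximations.
  refine ⟨φ, hφ.isWaveMap hp hm h1 h2, fun ψ hψ => incl_injective (tendsto_nhds_unique ?_ ht), ht⟩
  exact hb.tendsto_numericalScheme (hψ.rectControl hp hm) (hψ.apply_zero_right h0)
    hψ.apply_zero_left

theorem solutionMap_spec (hp : LocallyAC φp) (hm : LocallyAC φm) (h0 : φm 0 = φp 0) :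
    IsWaveMap φp φm (solutionMap φp φm) ∧
      (∀ ψ, IsWaveMap φp φm ψ → ψ = solutionMap φp φm) ∧
      Tendsto (fun N => numericalScheme N φp φm) atTop (𝓝 (incl (solutionMap φp φm))) := by
  obtain ⟨φ, h1, h2, h3⟩ := exists_isWaveMap hp hm h0
  have hs : IsWaveMap φp φm (solutionMap φp φm) := by
    rw [solutionMap, dif_pos ⟨φ, h1⟩]
    exact Exists.choose_spec (p := fun φ => IsWaveMap φp φm φ) _
  rw [h2 _ hs]
  exact ⟨h1, h2, h3⟩

end Uniqueness

/-! ### Random boundary data -/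

section Measurability

variable {d : ℕ}

/-- Near each point only finitely many values of the field enter, so joint continuity holds for the
product topology on fields; currying then gives continuity into the compact-open topology. -/
theorem continuous_bilinExtend_uncurry :
    Continuous fun x : (ℕ → ℕ → E d) × (ℝ≥0 × ℝ≥0) => bilinExtend x.1 x.2 := by
  have hlf : LocallyFinite fun i : ℕ × ℕ =>
      Icc (i.1 : ℝ≥0) (i.1 + 1) ×ˢ Icc (i.2 : ℝ≥0) (i.2 + 1) := by
    rintro ⟨u, v⟩
    refine ⟨Iio (u + 1) ×ˢ Iio (v + 1), (isOpen_Iio.prod isOpen_Iio).mem_nhds (by simp), ?_⟩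
    refine ((finite_Iic (⌊u + 1⌋₊)).prod (finite_Iic (⌊v + 1⌋₊))).subset ?_
    rintro ⟨m, n⟩ ⟨⟨a, b⟩, ⟨h1, h2⟩, h3, h4⟩
    exact ⟨Nat.le_floor (h1.1.trans (le_of_lt h3)), Nat.le_floor (h2.1.trans (le_of_lt h4))⟩
  refine (hlf.preimage_continuous
    (continuous_snd (X := ℕ → ℕ → E d) (Y := ℝ≥0 × ℝ≥0))).continuous ?_ ?_ ?_
  · refine eq_univ_of_forall fun x => mem_iUnion.2 ⟨(⌊x.2.1⌋₊, ⌊x.2.2⌋₊), ?_, ?_⟩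
    · exact ⟨Nat.floor_le bot_le, (Nat.lt_floor_add_one _).le⟩
    · exact ⟨Nat.floor_le bot_le, (Nat.lt_floor_add_one _).le⟩
  · exact fun i => (isClosed_Icc.prod isClosed_Icc).preimage continuous_snd
  · intro i
    refine ContinuousOn.congr (Continuous.continuousOn ?_)
      fun x hx => bilinExtend_eqOn x.1 i.1 i.2 hx
    fun_prop

/-- The interpolation of a discrete field on the dyadic points of mesh `2^{-N}`. -/
def interpolate (N : ℕ) (Y : ℕ → ℕ → E d) : C₂ d where
  toFun p := bilinExtend Y (2 ^ N * p.1, 2 ^ N * p.2)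
  continuous_toFun := (continuous_bilinExtend Y).comp (by fun_prop)

theorem continuous_interpolate (N : ℕ) : Continuous (interpolate (d := d) N) := by
  refine ContinuousMap.continuous_of_continuous_uncurry _ ?_
  exact continuous_bilinExtend_uncurry.comp
    (g := fun x : (ℕ → ℕ → E d) × (ℝ≥0 × ℝ≥0) => bilinExtend x.1 x.2)
    (f := fun x : (ℕ → ℕ → E d) × (ℝ≥0 × ℝ≥0) => (x.1, (2 ^ N * x.2.1, 2 ^ N * x.2.2)))
    (by fun_prop)

/-- Measurability is all that can be asked: the reflection is discontinuous at `Q = 0`. -/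
theorem measurable_lineReflection :
    Measurable fun x : E d × E d => lineReflection x.1 x.2 := by
  unfold lineReflection
  fun_prop

theorem measurable_lineReflection_add {α : Type*} [MeasurableSpace α] {f g h : α → E d}
    (hf : Measurable f) (hg : Measurable g) (hh : Measurable h) :
    Measurable fun x => lineReflection (f x + g x) (h x) := by
  have hfg : Measurable fun x => f x + g x := Measurable.add hf hg
  have hpair : Measurable fun x => (f x + g x, h x) := Measurable.prodMk hfg hh
  have hcomp := Measurable.comp (measurable_lineReflection (d := d)) hpair
  exact hcomp

theorem measurable_discreteWaveMap (m n : ℕ) :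
    Measurable fun Y : (ℕ → E d) × (ℕ → E d) => discreteWaveMap Y.1 Y.2 m n := by
  induction n generalizing m with
  | zero =>
    simp only [discreteWaveMap_zero_right]
    exact (measurable_pi_apply m).comp measurable_fst
  | succ n ih =>
    induction m with
    | zero =>
      have h : ∀ Y : (ℕ → E d) × (ℕ → E d), discreteWaveMap Y.1 Y.2 0 (n + 1) = Y.2 (n + 1) :=
        fun Y => by rw [discreteWaveMap]
      simp only [h]
      exact (measurable_pi_apply (n + 1)).comp measurable_snd
    | succ m ihm =>
      simp only [discreteWaveMap_succ_succ]
      exact measurable_lineReflection_add (ih (m + 1)) ihm (ih m)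

theorem measurable_schemeField (N : ℕ) :
    Measurable fun φ : X₁ d × X₁ d => schemeField N φ.1 φ.2 := by
  have eval : Measurable fun φ : X₁ d => fun m : ℕ => (φ ((m : ℝ≥0) / 2 ^ N) : E d) :=
    measurable_pi_iff.2 fun m =>
      (continuous_subtype_val.comp (continuous_eval_const _)).measurable
  refine measurable_pi_iff.2 fun m => measurable_pi_iff.2 fun n => ?_
  have h := (eval.comp measurable_fst).prodMk (eval.comp (measurable_snd (α := X₁ d)))
  exact (measurable_discreteWaveMap m n).comp h

theorem measurable_numericalScheme (N : ℕ) :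
    Measurable fun φ : X₁ d × X₁ d => numericalScheme N φ.1 φ.2 :=
  (continuous_interpolate N).measurable.comp (measurable_schemeField N)

theorem aemeasurable_numericalScheme {Ω : Type*} [MeasurableSpace Ω] {P : Measure Ω}
    {φp φm : Ω → X₁ d} (hφp : AEMeasurable φp P) (hφm : AEMeasurable φm P) (N : ℕ) :
    AEMeasurable (fun ω => numericalScheme N (φp ω) (φm ω)) P := by
  have hpair : AEMeasurable (fun ω => (φp ω, φm ω)) P := AEMeasurable.prodMk hφp hφm
  have hcomp := Measurable.comp_aemeasurable (measurable_numericalScheme (d := d) N) hpair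
  exact hcomp

/-- The range is cut out by the closed conditions `‖f p‖ = 1`. Hence measurability and laws may be
tested after the inclusion, which is where convergence takes place. -/
theorem isClosedEmbedding_incl : IsClosedEmbedding (incl (d := d)) := by
  refine ⟨ContinuousMap.isEmbedding_postcomp ⟨Subtype.val, continuous_subtype_val⟩
    IsEmbedding.subtypeVal, ?_⟩
  have : range (incl (d := d)) = ⋂ p, {f : C₂ d | ‖f p‖ = 1} := by
    ext f
    simp only [mem_range, mem_iInter, mem_ofPred_eq]
    refine ⟨?_, fun hf => ?_⟩
    · rintro ⟨φ, rfl⟩ p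
      simp [incl]
    · have hmem : ∀ p, f p ∈ Metric.sphere (0 : E d) 1 := fun p => by simpa using hf p
      exact ⟨⟨fun p => ⟨f p, hmem p⟩, f.continuous.subtype_mk hmem⟩, rfl⟩
  rw [this]
  exact isClosed_iInter fun p =>
    isClosed_eq (continuous_eval_const p).norm continuous_const

theorem measurableEmbedding_incl : MeasurableEmbedding (incl (d := d)) :=
  isClosedEmbedding_incl.measurableEmbedding

end Measurability

end WaveMaps

end

/-! ### Convergence in law and uniqueness of the law -/

theorem corollary4 {d : ℕ} {Ω : Type*} [MeasurableSpace Ω]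
    (P : Measure Ω) [IsProbabilityMeasure P]
    (φp φm : Ω → WaveMaps.X₁ d) (hφp : AEMeasurable φp P) (hφm : AEMeasurable φm P)
    (h_zero : ∀ᵐ ω ∂P, φm ω 0 = φp ω 0)
    (h_ac : ∀ᵐ ω ∂P, WaveMaps.LocallyAC (φp ω) ∧ WaveMaps.LocallyAC (φm ω)) :
    (∀ᵐ ω ∂P,
      WaveMaps.IsWaveMap (φp ω) (φm ω) (WaveMaps.solutionMap (φp ω) (φm ω)) ∧
      ∀ ψ : WaveMaps.X₂ d, WaveMaps.IsWaveMap (φp ω) (φm ω) ψ →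
        ψ = WaveMaps.solutionMap (φp ω) (φm ω)) ∧
    WaveMaps.IsSolution P φp φm P (fun ω => WaveMaps.solutionMap (φp ω) (φm ω)) ∧
    ∀ {Ω' : Type*} [MeasurableSpace Ω'] (P' : Measure Ω') [IsProbabilityMeasure P']
      (φ : Ω' → WaveMaps.X₂ d), WaveMaps.IsSolution P φp φm P' φ →
        IdentDistrib φ (fun ω => WaveMaps.solutionMap (φp ω) (φm ω)) P' P := by
  have spec : ∀ᵐ ω ∂P,
      WaveMaps.IsWaveMap (φp ω) (φm ω) (WaveMaps.solutionMap (φp ω) (φm ω)) ∧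
      (∀ ψ, WaveMaps.IsWaveMap (φp ω) (φm ω) ψ → ψ = WaveMaps.solutionMap (φp ω) (φm ω)) ∧
      Tendsto (fun N => WaveMaps.numericalScheme N (φp ω) (φm ω)) atTop
        (𝓝 (WaveMaps.incl (WaveMaps.solutionMap (φp ω) (φm ω)))) := by
    filter_upwards [h_zero, h_ac] with ω h0 hac
    exact WaveMaps.solutionMap_spec hac.1 hac.2 h0
  have hmeas : ∀ N, AEMeasurable (fun ω => WaveMaps.numericalScheme N (φp ω) (φm ω)) P :=
    WaveMaps.aemeasurable_numericalScheme hφp hφm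
  -- The solution map is defined by choice; its measurability comes only from being an almost sure
  -- limit of measurable approximations.
  have hlim : AEMeasurable (fun ω => WaveMaps.incl (WaveMaps.solutionMap (φp ω) (φm ω))) P :=
    aemeasurable_of_tendsto_metrizable_ae atTop hmeas (spec.mono fun _ h => h.2.2)
  have hsol : AEMeasurable (fun ω => WaveMaps.solutionMap (φp ω) (φm ω)) P :=
    WaveMaps.measurableEmbedding_incl.aemeasurable_comp_iff.1 hlim
  have conv : ∀ N : ℕ → ℕ, StrictMono N →
      TendstoInDistribution (fun k ω => WaveMaps.numericalScheme (N k) (φp ω) (φm ω)) atTop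
        (fun ω => WaveMaps.incl (WaveMaps.solutionMap (φp ω) (φm ω))) (fun _ => P) P :=
    fun N hN => tendstoInDistribution_of_ae_tendsto (fun k => hmeas (N k)) hlim
      (spec.mono fun _ h => h.2.2.comp hN.tendsto_atTop)
  refine ⟨spec.mono fun _ h => ⟨h.1, h.2.1⟩, ⟨hsol, id, strictMono_id, conv id strictMono_id⟩, ?_⟩
  intro Ω' _ P' _ φ hφ
  obtain ⟨N, hN, ht⟩ := hφ.exists_tendsto
  -- The whole sequence converges almost surely, so it converges in law to `solutionMap` along the
  -- subsequence defining `φ` as well.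
  have hlaw := tendstoInDistribution_unique _ ht (conv N hN)
  have emb := WaveMaps.measurableEmbedding_incl (d := d)
  refine ⟨hφ.aemeasurable, hsol, ?_⟩
  have e1 := AEMeasurable.map_map_of_aemeasurable emb.measurable.aemeasurable hφ.aemeasurable
  have e2 := AEMeasurable.map_map_of_aemeasurable emb.measurable.aemeasurable hsol
  have : (P'.map φ).map WaveMaps.incl =
      (P.map fun ω => WaveMaps.solutionMap (φp ω) (φm ω)).map WaveMaps.incl := by
    rw [e1, e2]
    exact hlaw
  -- Pushing forward along a measurable embedding loses no information about the law.
  rw [← emb.comap_map (P'.map φ), this, emb.comap_map]
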